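/- **Model.** Let $d\ge 1$ and let $\mathcal G$ be either the orthogonal group $\mathcal O(d)$, or the rotation group $\mathcal{SO}(d)$ with $d\ge 2$. Let $n$ nodes be partitioned into $K\ge 1$ clusters of equal size $m=n/K\ge 1$ by a clustering function $C^*:[n]\to[K]$, and let $\bm R_1^*,\dots,\bm R_n^*\in\mathcal G$ be arbitrary group elements. Let $p,q\in[0,1]$. The stochastic group block model $\mathrm{SGBM}(n,p,q,K,d,\mathcal G)$ generates a random matrix $\bm A\in\mathbb R^{nd\times nd}$ with $d\times d$ blocks $$\bm A_{ij}=\begin{cases} w_{ij}\,\bm R_i^*\bm R_j^{*\top}, & i<j,\ C^*(i)=C^*(j),\\ u_{ij}\,\bm R_{ij}, & i<j,\ C^*(i)\ne C^*(j),\\ \bm A_{ji}^\top, & i>j,\\ \bm I_d, & i=j,\end{cases}$$ where $w_{ij}\sim\mathrm{Bern}(p)$, $u_{ij}\sim\mathrm{Bern}(q)$ and $\bm R_{ij}\sim\mathrm{Unif}(\mathcal G)$ (normalised Haar measure) are all independent. Let $\bm V^*\in\mathbb R^{nd\times Kd}$ be the ground truth matrix whose $(i,k)$-th $d\times d$ block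 is $\bm R_i^*$ if $C^*(i)=k$ and $\bm 0$ otherwise, and let $\|\cdot\|$ be the operator norm (largest singular value). **Proposition.** For every $K$, $d$ and $\mathcal G$ as above there exist constants $c_1,c_2,c_3,\gamma>0$, depending only on $K$, $d$ and $\mathcal G$, such that for all $n$, $m$, $p$, $q$, $C^*$ and $\bm R_1^*,\dots,\bm R_n^*$ as above, $$\mathbb P\left(\left\|\bm A-p\,\bm V^*\bm V^{*\top}\right\|\le c_1\sqrt{qm}+c_2\sqrt{pm}+c_3\sqrt{\log n}\right)\ \ge\ 1-n^{-\gamma}.$$ -/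

import Mathlib

open MeasureTheory ProbabilityTheory

/-! ### The groups `O(d)` and `SO(d)` and their uniform distributions -/

/-- The two admissible groups: the orthogonal group `O(d)` and the rotation group `SO(d)`. -/
inductive GroupKind where
  | orthogonal
  | special

/-- `SO(d)`, as the subgroup of matrices of determinant one in `O(d)`. -/
def rotationSubgroup (d : ℕ) : Subgroup (Matrix.orthogonalGroup (Fin d) ℝ) where
  carrier := {Q | (Q : Matrix (Fin d) (Fin d) ℝ).det = 1}
  one_mem' := by simp
  mul_mem' := by
    intro a b ha hb
    simp only [Set.mem_ofPred_eq] at ha hb ⊢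
    simp [Matrix.det_mul, ha, hb]
  inv_mem' := by
    intro a ha
    simp only [Set.mem_ofPred_eq] at ha ⊢
    have h : ((a⁻¹ : Matrix.orthogonalGroup (Fin d) ℝ) : Matrix (Fin d) (Fin d) ℝ).det *
        (a : Matrix (Fin d) (Fin d) ℝ).det = 1 := by
      rw [← Matrix.det_mul, ← Submonoid.coe_mul, inv_mul_cancel]
      simp
    simpa [ha] using h

/-- The group `𝒢`, equal to `O(d)` or to `SO(d)`, as a subgroup of `O(d)`. -/
def syncSubgroup (d : ℕ) : GroupKind → Subgroup (Matrix.orthogonalGroup (Fin d) ℝ)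
  | .orthogonal => ⊤
  | .special => rotationSubgroup d

/-- The type of elements of `𝒢 ∈ {O(d), SO(d)}`. -/
abbrev SyncGroup (d : ℕ) (𝒢 : GroupKind) : Type := syncSubgroup d 𝒢

/-- The `d × d` matrix underlying an element of `𝒢`. -/
def SyncGroup.mat {d : ℕ} {𝒢 : GroupKind} (Q : SyncGroup d 𝒢) : Matrix (Fin d) (Fin d) ℝ :=
  ((Q : Matrix.orthogonalGroup (Fin d) ℝ) : Matrix (Fin d) (Fin d) ℝ)

instance compactSpace_orthogonalGroup (d : ℕ) :
    CompactSpace (Matrix.orthogonalGroup (Fin d) ℝ) := by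
  refine isCompact_iff_compactSpace.mp ?_
  have hsub : ((Matrix.orthogonalGroup (Fin d) ℝ : Submonoid _) :
      Set (Matrix (Fin d) (Fin d) ℝ)) ⊆
      Set.pi Set.univ (fun _ => Set.pi Set.univ (fun _ => Set.Icc (-1 : ℝ) 1)) := by
    intro U hU i _ j _
    have := entry_norm_bound_of_unitary (𝕜 := ℝ) hU i j
    rw [Real.norm_eq_abs] at this
    exact abs_le.mp this
  refine IsCompact.of_isClosed_subset
    (isCompact_univ_pi fun _ => isCompact_univ_pi fun _ => isCompact_Icc) ?_ hsub
  have : ((Matrix.orthogonalGroup (Fin d) ℝ : Submonoid _) : Set (Matrix (Fin d) (Fin d) ℝ)) =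
      {U | U * U.transpose = 1} := by
    ext U
    exact Matrix.mem_orthogonalGroup_iff (Fin d) ℝ
  rw [this]
  exact isClosed_eq (by fun_prop) continuous_const

instance compactSpace_syncGroup (d : ℕ) (𝒢 : GroupKind) : CompactSpace (SyncGroup d 𝒢) := by
  refine isCompact_iff_compactSpace.mp (IsClosed.isCompact ?_)
  cases 𝒢 with
  | orthogonal => exact isClosed_univ
  | special =>
    exact isClosed_eq (Continuous.matrix_det continuous_subtype_val) continuous_const

/-- `𝒢` carries its Borel `σ`-algebra. -/
instance measurableSpace_syncGroup (d : ℕ) (𝒢 : GroupKind) : MeasurableSpace (SyncGroup d 𝒢) :=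
  borel _

instance borelSpace_syncGroup (d : ℕ) (𝒢 : GroupKind) : BorelSpace (SyncGroup d 𝒢) := ⟨rfl⟩

/-- `Unif(𝒢)`: the Haar measure of the compact group `𝒢`, normalised to have total mass one. -/
noncomputable def unif (d : ℕ) (𝒢 : GroupKind) : Measure (SyncGroup d 𝒢) :=
  Measure.haarMeasure ⊤

instance isProbabilityMeasure_unif (d : ℕ) (𝒢 : GroupKind) :
    IsProbabilityMeasure (unif d 𝒢) :=
  ⟨by simpa [unif] using
    Measure.haarMeasure_self (K₀ := (⊤ : TopologicalSpace.PositiveCompacts (SyncGroup d 𝒢)))⟩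

/-! ### Clusterings and the ground truth matrix -/

/-- The nodes are `Fin n`, and `C i` is the cluster of node `i`. The clustering is balanced when
each of the `K` clusters has exactly `m` nodes (so that `n = K * m`). -/
def IsBalanced {n K : ℕ} (m : ℕ) (C : Fin n → Fin K) : Prop :=
  ∀ k : Fin K, (Finset.univ.filter fun i => C i = k).card = m

/-- The clustering matrix `H ∈ {0,1}^{n × K}` of a clustering function. -/
def clusteringMatrix {n K : ℕ} (C : Fin n → Fin K) : Matrix (Fin n) (Fin K) ℝ :=
  Matrix.of fun i k => if C i = k then 1 else 0

/-- `V = (1_{1×K} ⊗ R) ⊙ (H ⊗ 1_{d×d}) ∈ ℝ^{nd × Kd}`: its `(i,k)`-th `d × d` block is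
`H i k • R i`. -/
def groundTruth {n K d : ℕ} {𝒢 : GroupKind} (C : Fin n → Fin K) (R : Fin n → SyncGroup d 𝒢) :
    Matrix (Fin n × Fin d) (Fin K × Fin d) ℝ :=
  Matrix.of fun x y => (R x.1).mat x.2 y.2 * clusteringMatrix C x.1 y.1

/-! ### The stochastic group block model -/

/-- The unordered pairs of distinct nodes, written as `(i, j)` with `i < j`. -/
abbrev NodePair (n : ℕ) : Type := {e : Fin n × Fin n // e.1 < e.2}

/-- An outcome: for each pair `i < j`, the indicator of the edge `{i, j}` and a group element
(the outlier measurement, which is used only when `i` and `j` lie in different clusters). -/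
abbrev SGBMOutcome (n d : ℕ) (𝒢 : GroupKind) : Type := NodePair n → Bool × SyncGroup d 𝒢

/-- The probability measure of the stochastic group block model: all edge indicators and all
outlier measurements are independent; the edge `{i, j}` is present with probability `p` if `i` and
`j` lie in the same cluster and with probability `q` otherwise; outliers are uniform on `𝒢`. -/
noncomputable def sgbm {n K : ℕ} (p q : unitInterval) (C : Fin n → Fin K) (d : ℕ)
    (𝒢 : GroupKind) : Measure (SGBMOutcome n d 𝒢) :=
  Measure.pi fun e : NodePair n =>
    (bernoulliMeasure true false (if C e.1.1 = C e.1.2 then p else q)).prod (unif d 𝒢)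

instance isProbabilityMeasure_sgbm {n K : ℕ} (p q : unitInterval) (C : Fin n → Fin K) (d : ℕ)
    (𝒢 : GroupKind) : IsProbabilityMeasure (sgbm p q C d 𝒢) := by
  unfold sgbm
  infer_instance

/-- The observed block `A_{ij}` for a pair `i < j`. -/
def upperBlock {n K d : ℕ} {𝒢 : GroupKind} (C : Fin n → Fin K) (R : Fin n → SyncGroup d 𝒢)
    (ω : SGBMOutcome n d 𝒢) (e : NodePair n) : Matrix (Fin d) (Fin d) ℝ :=
  if (ω e).1 = true then
    if C e.1.1 = C e.1.2 then (R e.1.1).mat * (R e.1.2).mat.transpose else (ω e).2.mat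
  else 0

/-- The observed block `A_{ij}`: `A_{ij} = A_{ji}ᵀ` below the diagonal, and `A_{ii} = I_d`. -/
def observationBlock {n K d : ℕ} {𝒢 : GroupKind} (C : Fin n → Fin K)
    (R : Fin n → SyncGroup d 𝒢) (ω : SGBMOutcome n d 𝒢) (i j : Fin n) :
    Matrix (Fin d) (Fin d) ℝ :=
  if hij : i < j then upperBlock C R ω ⟨(i, j), hij⟩
  else if hji : j < i then (upperBlock C R ω ⟨(j, i), hji⟩).transpose
  else 1

/-- The random observation matrix `A ∈ ℝ^{nd × nd}`. -/
def observation {n K d : ℕ} {𝒢 : GroupKind} (C : Fin n → Fin K) (R : Fin n → SyncGroup d 𝒢)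
    (ω : SGBMOutcome n d 𝒢) : Matrix (Fin n × Fin d) (Fin n × Fin d) ℝ :=
  Matrix.of fun x y => observationBlock C R ω x.1 y.1 x.2 y.2

/-- The operator norm (largest singular value) of a square real matrix: its norm as a linear
operator on Euclidean space. -/
noncomputable def opNorm {ι : Type} [Fintype ι] [DecidableEq ι] (X : Matrix ι ι ℝ) : ℝ :=
  ‖Matrix.toEuclideanCLM (n := ι) (𝕜 := ℝ) X‖

/-! ### Walks and traces of powers -/

/-! Up to the term `(1 - p) • 1` from the diagonal blocks, the deviation is a symmetric matrix `M`
with independent centred off-diagonal blocks. Their entries are bounded by variables of mean at most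
`ρ = min 1 (2 max(p, q))`. The task is to show that `‖M‖` is of order `√(nρ + log n)`, with `n = K
m`; the method is to bound the expected trace of `M ^ (2k)` for `k ≈ nρ + log n`.

In the expansion of the trace over walks, independence and centring kill every walk that is not
closed and loop-free with each edge traversed at least twice. A surviving walk on `v` nodes uses at
least `v - 1` distinct edges, so it contributes at most `ρ ^ (v - 1)`; the indices inside the blocks
cost a factor `d ^ (2k + 1)` (`integral_trace_pow_edgeMatrix_le`).

The surviving walks are not enumerated; they are compared with a model whose norm is easy to bound.
A shape on `v` vertices has at most `n ^ v` realisations on `n` nodes and at least `k ^ v` on `3k`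
nodes. Since `nρ ≤ k`, the weighted sum is at most `n` times the number of doubled closed walks on
`3k` nodes (`sum_doubledClosedWalk_le`). That number is at most the expected trace of the same power
of a `3k × 3k` symmetric matrix with independent bounded centred entries whose moments, except the
first, are all at least one (`card_doubledClosedWalk_le_integral_trace`). Its size is comparable to
the exponent, so a crude net argument, with loss exponential in `k`, gives `(10 ^ 9 * k) ^ k`
(`card_doubledClosedWalk_le`).

Markov's inequality at a level of order `√k` then has failure probability at most `n e ^ (-2k) ≤ 1 /
n`, because `k ≥ log n` (`measureReal_opNorm_edgeMatrix_le`). -/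

theorem matrix_pow_apply_eq_sum_walks {ι : Type*} [Fintype ι] [DecidableEq ι]
    (M : Matrix ι ι ℝ) (L : ℕ) (i j : ι) :
    (M ^ L) i j = ∑ w : Fin (L + 1) → ι,
      if w 0 = i ∧ w (Fin.last L) = j then ∏ t : Fin L, M (w t.castSucc) (w t.succ) else 0 := by
  induction L generalizing i with
  | zero =>
    rw [Fintype.sum_equiv (Equiv.funUnique (Fin 1) ι) _
      (fun x => if x = i then if x = j then (1 : ℝ) else 0 else 0) fun w => by simp [ite_and]]
    simp [Matrix.one_apply]
  | succ L ih =>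
    rw [pow_succ', Matrix.mul_apply, ← (Fin.consEquiv (fun _ : Fin (L + 2) => ι)).sum_comp,
      Fintype.sum_prod_type]
    simp only [Fin.consEquiv_apply, Fin.cons_zero, ← Fin.succ_last, Fin.cons_succ,
      Fin.prod_univ_succ (n := L), Fin.castSucc_zero, ih, ite_and, Fin.castSucc_succ]
    simp only [Finset.mul_sum, Finset.sum_ite_irrel, Finset.sum_const_zero, Finset.sum_ite_eq',
      Finset.mem_univ, if_true]
    rw [Finset.sum_comm]
    refine Finset.sum_congr rfl fun w _ => ?_
    simp

theorem matrix_trace_pow_eq_sum_walks {ι : Type*} [Fintype ι] [DecidableEq ι]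
    (M : Matrix ι ι ℝ) (L : ℕ) :
    (M ^ L).trace = ∑ w : Fin (L + 1) → ι,
      if w 0 = w (Fin.last L) then ∏ t : Fin L, M (w t.castSucc) (w t.succ) else 0 := by
  simp only [Matrix.trace, Matrix.diag_apply, matrix_pow_apply_eq_sum_walks]
  rw [Finset.sum_comm]
  refine Finset.sum_congr rfl fun w _ => ?_
  simp only [ite_and]
  simp [eq_comm]

/-! ### Operator norms, traces and nets -/

section OpNorm

variable {ι : Type} [Fintype ι] [DecidableEq ι]

theorem opNorm_nonneg (X : Matrix ι ι ℝ) : 0 ≤ opNorm X := norm_nonneg _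

theorem opNorm_add_le (X Y : Matrix ι ι ℝ) : opNorm (X + Y) ≤ opNorm X + opNorm Y := by
  simpa [opNorm] using norm_add_le (Matrix.toEuclideanCLM (n := ι) (𝕜 := ℝ) X)
    (Matrix.toEuclideanCLM (n := ι) (𝕜 := ℝ) Y)

theorem opNorm_smul_one_le (c : ℝ) : opNorm (c • (1 : Matrix ι ι ℝ)) ≤ |c| := by
  unfold opNorm
  rw [map_smul, map_one, norm_smul, Real.norm_eq_abs]
  exact mul_le_of_le_one_right (abs_nonneg _) ContinuousLinearMap.norm_id_le

theorem opNorm_pow_le (X : Matrix ι ι ℝ) {k : ℕ} (hk : 0 < k) : opNorm (X ^ k) ≤ opNorm X ^ k := by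
  simpa [opNorm] using norm_pow_le' (Matrix.toEuclideanCLM (n := ι) (𝕜 := ℝ) X) hk

theorem inner_toEuclideanCLM (X : Matrix ι ι ℝ) (x y : EuclideanSpace ℝ ι) :
    inner ℝ x (Matrix.toEuclideanCLM (n := ι) (𝕜 := ℝ) X y) = ∑ i, ∑ j, x i * X i j * y j := by
  simp [PiLp.inner_apply, Matrix.mulVec, dotProduct, Finset.mul_sum, mul_comm, mul_left_comm, mul_assoc]

theorem abs_apply_le_opNorm (X : Matrix ι ι ℝ) (i j : ι) : |X i j| ≤ opNorm X := by
  have h := inner_toEuclideanCLM X (EuclideanSpace.single i 1) (EuclideanSpace.single j 1)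
  have h2 : inner ℝ (EuclideanSpace.single i (1 : ℝ)) (Matrix.toEuclideanCLM (n := ι) (𝕜 := ℝ) X
      (EuclideanSpace.single j 1)) = X i j := by
    rw [h]
    simp
  rw [← h2]
  refine (abs_real_inner_le_norm _ _).trans ?_
  have := (Matrix.toEuclideanCLM (n := ι) (𝕜 := ℝ) X).le_opNorm (EuclideanSpace.single j 1)
  simpa [opNorm] using this

theorem trace_le_card_mul_opNorm (X : Matrix ι ι ℝ) :
    X.trace ≤ Fintype.card ι * opNorm X := by
  calc X.trace ≤ ∑ _i : ι, opNorm X :=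
        Finset.sum_le_sum fun i _ => (le_abs_self _).trans (abs_apply_le_opNorm X i i)
    _ = _ := by simp

/-- The C*-identity gives equality for exponents that are powers of two. Splitting `a ^ 2 ^ k` as `a
^ k * a ^ (2 ^ k - k)` and using submultiplicativity passes to an arbitrary `k`. -/
theorem IsSelfAdjoint.norm_pow_le_norm_pow {E : Type*} [NormedRing E] [StarRing E] [CStarRing E]
    {a : E} (ha : IsSelfAdjoint a) (k : ℕ) (hk : 0 < k) : ‖a‖ ^ k ≤ ‖a ^ k‖ := by
  rcases eq_or_ne a 0 with rfl | h0
  · simp [hk.ne']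
  have hpos : 0 < ‖a‖ := norm_pos_iff.mpr h0
  have hlt : k < 2 ^ k := Nat.lt_two_pow_self
  have h1 := ha.norm_pow_two_pow k
  have h2 : a ^ 2 ^ k = a ^ k * a ^ (2 ^ k - k) := by rw [← pow_add]; congr 1; omega
  have h3 : ‖a‖ ^ 2 ^ k = ‖a‖ ^ k * ‖a‖ ^ (2 ^ k - k) := by rw [← pow_add]; congr 1; omega
  have h4 : ‖a ^ (2 ^ k - k)‖ ≤ ‖a‖ ^ (2 ^ k - k) := norm_pow_le' a (by omega)
  have h5 : ‖a‖ ^ k * ‖a‖ ^ (2 ^ k - k) ≤ ‖a ^ k‖ * ‖a‖ ^ (2 ^ k - k) := by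
    rw [← h3, ← h1, h2]
    exact (norm_mul_le _ _).trans (by gcongr)
  exact le_of_mul_le_mul_right h5 (by positivity)

/-- The trace is the squared Hilbert–Schmidt norm; Cauchy–Schwarz in each row shows that it
dominates the operator norm. -/
theorem opNorm_sq_le_trace (X : Matrix ι ι ℝ) : opNorm X ^ 2 ≤ (X * X.transpose).trace := by
  have hT : (X * X.transpose).trace = ∑ i, ∑ j, X i j ^ 2 := by
    simp [Matrix.trace, Matrix.mul_apply, sq]
  have hnn : 0 ≤ ∑ i, ∑ j, X i j ^ 2 := by positivity
  rw [hT]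
  refine (Real.le_sqrt (opNorm_nonneg X) hnn).mp ?_
  refine ContinuousLinearMap.opNorm_le_bound _ (Real.sqrt_nonneg _) fun x => ?_
  rw [EuclideanSpace.norm_eq, EuclideanSpace.norm_eq, ← Real.sqrt_mul hnn]
  refine Real.sqrt_le_sqrt ?_
  rw [Finset.sum_mul]
  refine Finset.sum_le_sum fun i _ => ?_
  simp only [Real.norm_eq_abs, sq_abs, Matrix.ofLp_toEuclideanCLM, Matrix.mulVec, dotProduct]
  exact Finset.sum_mul_sq_le_sq_mul_sq _ _ _

theorem opNorm_pow_two_mul_le_trace {X : Matrix ι ι ℝ} (hX : X.transpose = X) {k : ℕ}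
    (hk : 0 < k) : opNorm X ^ (2 * k) ≤ (X ^ (2 * k)).trace := by
  have hsa : IsSelfAdjoint (Matrix.toEuclideanCLM (n := ι) (𝕜 := ℝ) X) := by
    have : IsSelfAdjoint X := by
      rw [IsSelfAdjoint, Matrix.star_eq_conjTranspose, Matrix.conjTranspose_eq_transpose_of_trivial,
        hX]
    exact this.map _
  have h1 : opNorm X ^ k ≤ opNorm (X ^ k) := by
    simpa [opNorm] using hsa.norm_pow_le_norm_pow k hk
  calc opNorm X ^ (2 * k) = (opNorm X ^ k) ^ 2 := by rw [mul_comm, pow_mul]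
    _ ≤ opNorm (X ^ k) ^ 2 := by gcongr; exact pow_nonneg (opNorm_nonneg _) _
    _ ≤ _ := opNorm_sq_le_trace _
    _ = _ := by rw [Matrix.transpose_pow, hX, ← pow_add, two_mul]

end OpNorm

/-- A `1/2`-net of the unit ball of cardinality at most `5 ^ dim`. -/
theorem exists_half_net (E : Type*) [NormedAddCommGroup E] [NormedSpace ℝ E]
    [FiniteDimensional ℝ E] :
    ∃ N : Finset E, N.card ≤ 5 ^ Module.finrank ℝ E ∧ (∀ x ∈ N, ‖x‖ ≤ 1) ∧
      ∀ x : E, ‖x‖ ≤ 1 → ∃ y ∈ N, ‖x - y‖ ≤ 1 / 2 := by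
  classical
  -- The net is half of a maximal 1-separated subset of the ball of radius 2, the scale at which the
  -- volume bound `5 ^ dim` is available. A point `x` far from the net would allow `2x` to be added,
  -- against maximality.
  let S : Set (Finset E) := {s | (∀ c ∈ s, ‖c‖ ≤ 2) ∧ ∀ c ∈ s, ∀ d ∈ s, c ≠ d → 1 ≤ ‖c - d‖}
  have hbdd : BddAbove (Finset.card '' S) :=
    ⟨5 ^ Module.finrank ℝ E, by
      rintro _ ⟨s, hs, rfl⟩
      exact Besicovitch.card_le_of_separated s hs.1 hs.2⟩
  have hne : (Finset.card '' S).Nonempty := ⟨_, ∅, by simp [S], rfl⟩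
  obtain ⟨s, hs, hcard⟩ := Nat.sSup_mem hne hbdd
  refine ⟨s.image fun x => (1 / 2 : ℝ) • x,
    Finset.card_image_le.trans (Besicovitch.card_le_of_separated s hs.1 hs.2), ?_, ?_⟩
  · intro x hx
    obtain ⟨y, hy, rfl⟩ := Finset.mem_image.mp hx
    rw [norm_smul]
    have := hs.1 y hy
    norm_num
    linarith
  · intro x hx
    by_contra! hcon
    have hfar : ∀ y ∈ s, 1 < ‖(2 : ℝ) • x - y‖ := by
      intro y hy
      have := hcon _ (Finset.mem_image_of_mem _ hy)
      have h2 : (2 : ℝ) • x - y = (2 : ℝ) • (x - (1 / 2 : ℝ) • y) := by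
        rw [smul_sub, smul_smul]; norm_num
      rw [h2, norm_smul]
      norm_num at this ⊢
      linarith
    have hnot : (2 : ℝ) • x ∉ s := by
      intro h
      have := hfar _ h
      simp at this
      linarith
    have hins : insert ((2 : ℝ) • x) s ∈ S := by
      constructor
      · intro c hc
        rcases Finset.mem_insert.mp hc with rfl | hc
        · rw [norm_smul]; norm_num; linarith
        · exact hs.1 c hc
      · intro c hc e he hne
        rcases Finset.mem_insert.mp hc with rfl | hc <;> rcases Finset.mem_insert.mp he with rfl | he
        · exact absurd rfl hne
        · exact (hfar e he).le
        · rw [norm_sub_rev]; exact (hfar c hc).le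
        · exact hs.2 c hc e he hne
    have := le_csSup hbdd ⟨_, hins, rfl⟩
    rw [Finset.card_insert_of_notMem hnot, ← hcard] at this
    omega

/-- Replacing a unit vector by a net point costs at most `‖T‖ / 2`, which is absorbed into the left
side. -/
theorem norm_le_two_mul_of_half_net {E F : Type*} [NormedAddCommGroup E] [NormedSpace ℝ E]
    [NormedAddCommGroup F] [NormedSpace ℝ F] {N : Finset E}
    (hN : ∀ x : E, ‖x‖ ≤ 1 → ∃ y ∈ N, ‖x - y‖ ≤ 1 / 2) (T : E →L[ℝ] F) {B : ℝ}
    (hB : ∀ y ∈ N, ‖T y‖ ≤ B) : ‖T‖ ≤ 2 * B := by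
  have hB0 : 0 ≤ B := by
    obtain ⟨y, hy, -⟩ := hN 0 (by simp)
    exact (norm_nonneg _).trans (hB y hy)
  have key : ‖T‖ ≤ B + ‖T‖ * (1 / 2) := by
    refine ContinuousLinearMap.opNorm_le_of_unit_norm (by positivity) fun x hx => ?_
    obtain ⟨y, hy, hxy⟩ := hN x hx.le
    calc ‖T x‖ = ‖T y + T (x - y)‖ := by rw [← map_add]; congr 2; abel
      _ ≤ ‖T y‖ + ‖T (x - y)‖ := norm_add_le _ _
      _ ≤ B + ‖T‖ * (1 / 2) := by
        gcongr
        · exact hB y hy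
        · exact (T.le_opNorm _).trans (by gcongr)
  linarith

theorem opNorm_le_four_mul_of_half_net {ι : Type} [Fintype ι] [DecidableEq ι]
    {N : Finset (EuclideanSpace ℝ ι)}
    (hN : ∀ x : EuclideanSpace ℝ ι, ‖x‖ ≤ 1 → ∃ y ∈ N, ‖x - y‖ ≤ 1 / 2) (X : Matrix ι ι ℝ) {B : ℝ}
    (hB : ∀ x ∈ N, ∀ y ∈ N, |∑ i, ∑ j, x i * X i j * y j| ≤ B) : opNorm X ≤ 4 * B := by
  have : ∀ y ∈ N, ‖Matrix.toEuclideanCLM (n := ι) (𝕜 := ℝ) X y‖ ≤ 2 * B := by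
    intro y hy
    rw [← innerSL_apply_norm (𝕜 := ℝ)]
    refine norm_le_two_mul_of_half_net hN _ fun x hx => ?_
    rw [innerSL_apply_apply, real_inner_comm, inner_toEuclideanCLM]
    exact hB x hx y hy
  have := norm_le_two_mul_of_half_net hN _ this
  unfold opNorm
  linarith

/-- The maximum over pairs of net points is replaced by a sum of even powers, whose expectation can
be taken term by term. -/
theorem opNorm_pow_le_sum_of_half_net {ι : Type} [Fintype ι] [DecidableEq ι]
    {N : Finset (EuclideanSpace ℝ ι)}
    (hN : ∀ x : EuclideanSpace ℝ ι, ‖x‖ ≤ 1 → ∃ y ∈ N, ‖x - y‖ ≤ 1 / 2) (X : Matrix ι ι ℝ)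
    {k : ℕ} (hk : 0 < k) :
    opNorm X ^ (2 * k) ≤ 16 ^ k * ∑ x ∈ N, ∑ y ∈ N, (∑ i, ∑ j, x i * X i j * y j) ^ (2 * k) := by
  have hle : ∀ f : EuclideanSpace ℝ ι → EuclideanSpace ℝ ι → ℝ, (∀ x y, 0 ≤ f x y) →
      ∀ x ∈ N, ∀ y ∈ N, f x y ≤ ∑ x ∈ N, ∑ y ∈ N, f x y := fun f hf x hx y hy =>
    (Finset.single_le_sum (fun y _ => hf x y) hy).trans
      (Finset.single_le_sum (f := fun x => ∑ y ∈ N, f x y)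
        (fun x _ => Finset.sum_nonneg fun y _ => hf x y) hx)
  set S := ∑ x ∈ N, ∑ y ∈ N, (∑ i, ∑ j, x i * X i j * y j) ^ (2 * k) with hS
  have hnn : ∀ a : ℝ, 0 ≤ a ^ (2 * k) := fun a => (even_two_mul k).pow_nonneg a
  have hS0 : 0 ≤ S := Finset.sum_nonneg fun x _ => Finset.sum_nonneg fun y _ => hnn _
  set B := S ^ ((1 : ℝ) / (2 * k : ℕ)) with hBdef
  have hB0 : 0 ≤ B := Real.rpow_nonneg hS0 _
  have hBS : B ^ (2 * k) = S := by
    rw [hBdef, one_div]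
    exact Real.rpow_inv_natCast_pow hS0 (by omega)
  have h := opNorm_le_four_mul_of_half_net hN X (B := B) fun x hx y hy => by
    refine le_of_pow_le_pow_left₀ (n := 2 * k) (by omega) hB0 ?_
    rw [(even_two_mul k).pow_abs, hBS, hS]
    exact hle (fun x y => (∑ i, ∑ j, x i * X i j * y j) ^ (2 * k)) (fun _ _ => hnn _) x hx y hy
  calc opNorm X ^ (2 * k) ≤ (4 * B) ^ (2 * k) := by gcongr; exact opNorm_nonneg _
    _ = 16 ^ k * S := by rw [mul_pow, hBS, pow_mul]; norm_num

/-! ### Walks up to relabelling of the vertices -/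

section Walks

variable {L : ℕ} {α β : Type*}

/-- A closed walk without loops which traverses each of its edges at least twice. -/
def IsDoubledClosedWalk (w : Fin (L + 1) → α) : Prop :=
  w 0 = w (Fin.last L) ∧ (∀ t : Fin L, w t.castSucc ≠ w t.succ) ∧
    ∀ t : Fin L, ∃ t' : Fin L, t' ≠ t ∧ s(w t'.castSucc, w t'.succ) = s(w t.castSucc, w t.succ)

/-- Two walks agree up to a relabelling of the vertices. -/
def SameShape (u : Fin (L + 1) → α) (w : Fin (L + 1) → β) : Prop :=
  ∀ a b, u a = u b ↔ w a = w b

theorem SameShape.symm {u : Fin (L + 1) → α} {w : Fin (L + 1) → β} (h : SameShape u w) :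
    SameShape w u := fun a b => (h a b).symm

theorem SameShape.isDoubledClosedWalk_iff {u : Fin (L + 1) → α} {w : Fin (L + 1) → β}
    (h : SameShape u w) : IsDoubledClosedWalk u ↔ IsDoubledClosedWalk w := by
  simp only [IsDoubledClosedWalk, Sym2.eq_iff, ne_eq, h _ _]

/-- The number of vertices visited by a walk. -/
def vertexCount [DecidableEq α] (w : Fin (L + 1) → α) : ℕ := (Finset.univ.image w).card

theorem vertexCount_pos [DecidableEq α] (w : Fin (L + 1) → α) : 0 < vertexCount w :=
  Finset.card_pos.mpr ⟨w 0, Finset.mem_image_of_mem _ (Finset.mem_univ _)⟩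

theorem vertexCount_le [DecidableEq α] (w : Fin (L + 1) → α) : vertexCount w ≤ L + 1 :=
  Finset.card_image_le.trans (by simp)

theorem SameShape.exists_relabel {u : Fin (L + 1) → α} {w : Fin (L + 1) → β}
    (h : SameShape u w) [DecidableEq α] :
    ∃ g : {x // x ∈ Finset.univ.image u} → β, ∀ a,
      w a = g ⟨u a, Finset.mem_image_of_mem _ (Finset.mem_univ _)⟩ := by
  have : ∀ x : {x // x ∈ Finset.univ.image u}, ∃ a, u a = x := fun x => by
    obtain ⟨a, -, ha⟩ := Finset.mem_image.mp x.2
    exact ⟨a, ha⟩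
  choose f hf using this
  exact ⟨fun x => w (f x), fun a => (h _ _).mp (hf ⟨u a, _⟩).symm⟩

theorem SameShape.vertexCount_le_vertexCount [DecidableEq α] [DecidableEq β]
    {u : Fin (L + 1) → α} {w : Fin (L + 1) → β}
    (h : SameShape u w) : vertexCount w ≤ vertexCount u := by
  obtain ⟨g, hg⟩ := h.exists_relabel
  have : Finset.univ.image w ⊆ (Finset.univ.image u).attach.image g := by
    intro y hy
    obtain ⟨a, -, rfl⟩ := Finset.mem_image.mp hy
    rw [hg]
    exact Finset.mem_image_of_mem _ (Finset.mem_attach _ _)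
  exact (Finset.card_le_card this).trans (Finset.card_image_le.trans (by simp [vertexCount]))

theorem SameShape.vertexCount_eq [DecidableEq α] [DecidableEq β]
    {u : Fin (L + 1) → α} {w : Fin (L + 1) → β}
    (h : SameShape u w) : vertexCount w = vertexCount u :=
  le_antisymm h.vertexCount_le_vertexCount h.symm.vertexCount_le_vertexCount

-- A walk with the shape of `u` is determined by a labelling of the vertices of `u`.
open Classical in
theorem card_sameShape_le [DecidableEq α] [Fintype β] (u : Fin (L + 1) → α) :
    (Finset.univ.filter fun w : Fin (L + 1) → β => SameShape u w).card ≤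
      Fintype.card β ^ vertexCount u := by
  have hcard (V : Finset α) : Fintype.card ({x // x ∈ V} → β) = Fintype.card β ^ V.card := by simp
  rw [vertexCount, ← hcard, ← Finset.card_univ]
  refine Finset.card_le_card_of_surjOn
    (fun g a => g ⟨u a, Finset.mem_image_of_mem _ (Finset.mem_univ _)⟩) ?_
  intro w hw
  obtain ⟨g, hg⟩ := SameShape.exists_relabel (u := u) (w := w) (by simpa using hw)
  exact ⟨g, by simp, funext fun a => (hg a).symm⟩

-- Injective labellings of the vertices of `u` preserve its shape, and distinct labellings give
-- distinct walks.
open Classical in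
theorem descFactorial_le_card_sameShape [DecidableEq α] [Fintype β] (u : Fin (L + 1) → α) :
    (Fintype.card β).descFactorial (vertexCount u) ≤
      (Finset.univ.filter fun w : Fin (L + 1) → β => SameShape u w).card := by
  have hcard (V : Finset α) : Fintype.card ({x // x ∈ V} ↪ β) =
      (Fintype.card β).descFactorial V.card := by
    rw [Fintype.card_embedding_eq, Fintype.card_coe]
  rw [vertexCount, ← hcard, ← Finset.card_univ]
  refine Finset.card_le_card_of_injOn
    (fun g a => g ⟨u a, Finset.mem_image_of_mem _ (Finset.mem_univ _)⟩) ?_ ?_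
  · intro g _
    exact Finset.mem_coe.mpr (Finset.mem_filter.mpr ⟨Finset.mem_univ _, fun a b => by simp⟩)
  · intro g _ g' _ h
    ext x
    obtain ⟨x, hx⟩ := x
    obtain ⟨a, -, rfl⟩ := Finset.mem_image.mp hx
    exact congrFun h a

/-- Each vertex after the first is discovered along an edge not used before. -/
theorem vertexCount_le_card_edges_add_one [DecidableEq α] (u : Fin (L + 1) → α) :
    vertexCount u ≤
      (Finset.univ.image fun t : Fin L => s(u t.castSucc, u t.succ)).card + 1 := by
  induction L with
  | zero => exact vertexCount_le u
  | succ L ih =>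
    have ih := ih (fun a => u a.castSucc)
    set V := Finset.univ.image fun a : Fin (L + 1) => u a.castSucc with hV
    set F := Finset.univ.image fun t : Fin L => s(u t.castSucc.castSucc, u t.succ.castSucc) with hF
    have hVu : Finset.univ.image u = insert (u (Fin.last (L + 1))) V := by
      ext x
      simp only [hV, Finset.mem_image, Finset.mem_univ, true_and, Finset.mem_insert,
        Fin.exists_fin_succ' (n := L + 1)]
      tauto
    have hFu : (Finset.univ.image fun t : Fin (L + 1) => s(u t.castSucc, u t.succ)) =
        insert s(u (Fin.last L).castSucc, u (Fin.last (L + 1))) F := by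
      ext x
      simp only [hF, Finset.mem_image, Finset.mem_univ, true_and, Finset.mem_insert,
        Fin.exists_fin_succ' (n := L), Fin.succ_last, Fin.succ_castSucc]
      tauto
    have ih : V.card ≤ F.card + 1 := ih
    rw [vertexCount, hVu, hFu]
    by_cases hmem : u (Fin.last (L + 1)) ∈ V
    · rw [Finset.insert_eq_of_mem hmem]
      exact ih.trans (Nat.add_le_add_right (Finset.card_le_card (Finset.subset_insert _ _)) 1)
    · have hnew : s(u (Fin.last L).castSucc, u (Fin.last (L + 1))) ∉ F := by
        intro h
        obtain ⟨t, -, ht⟩ := Finset.mem_image.mp h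
        have hm : u (Fin.last (L + 1)) ∈ s(u t.castSucc.castSucc, u t.succ.castSucc) := by
          rw [ht]; exact Sym2.mem_mk_right _ _
        rcases Sym2.mem_iff.mp hm with h | h <;>
          exact hmem (h ▸ Finset.mem_image_of_mem _ (Finset.mem_univ _))
      rw [Finset.card_insert_of_notMem hmem, Finset.card_insert_of_notMem hnew]
      omega

open Classical in
/-- Walks on `n` vertices, weighted by `ρ` for each vertex but the first, are at most `n` times as
many as the walks on `r` vertices, when `r` exceeds the length by more than `n ρ`. -/
theorem sum_doubledClosedWalk_le {n r : ℕ} {ρ : ℝ} (hρ : 0 ≤ ρ) {k : ℕ} (hk : 0 < k)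
    (hnρ : n * ρ ≤ k) (hr : r = L + k) :
    (∑ u : Fin (L + 1) → Fin n, if IsDoubledClosedWalk u then ρ ^ (vertexCount u - 1) else 0) ≤
      n * (Finset.univ.filter fun w : Fin (L + 1) → Fin r => IsDoubledClosedWalk w).card := by
  -- A lower bound for the number of walks on `r` nodes with a given shape on `v` vertices: the
  -- falling factorial is at least `(r + 1 - v) ^ v`, and `v ≤ L + 1` with `r = L + k` leaves a base
  -- of at least `k`.
  let D : ℕ → ℝ := fun v => (k : ℝ) ^ v
  have hk0 : (0 : ℝ) < k := by exact_mod_cast hk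
  have hD : ∀ v, 0 < D v := fun v => by positivity
  have h1 : ∀ u : Fin (L + 1) → Fin n, D (vertexCount u) ≤
      ∑ w : Fin (L + 1) → Fin r, if SameShape u w then (1 : ℝ) else 0 := by
    intro u
    have ha := descFactorial_le_card_sameShape (β := Fin r) u
    have hb := Nat.pow_sub_le_descFactorial r (vertexCount u)
    have hc : k ^ vertexCount u ≤ (r + 1 - vertexCount u) ^ vertexCount u :=
      Nat.pow_le_pow_left (by have := vertexCount_le u; omega) _
    rw [Fintype.card_fin] at ha
    rw [Finset.sum_boole]
    change (k : ℝ) ^ _ ≤ _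
    exact_mod_cast hc.trans (hb.trans ha)
  have h2 : ∀ w : Fin (L + 1) → Fin r,
      (∑ u : Fin (L + 1) → Fin n, if SameShape u w then (1 : ℝ) else 0) ≤ n ^ vertexCount w := by
    intro w
    have ha := card_sameShape_le (β := Fin n) w
    rw [Fintype.card_fin] at ha
    rw [Finset.sum_boole]
    have hb : (Finset.univ.filter fun u : Fin (L + 1) → Fin n => SameShape u w) =
        Finset.univ.filter fun u : Fin (L + 1) → Fin n => SameShape w u :=
      Finset.filter_congr fun u _ => ⟨SameShape.symm, SameShape.symm⟩
    rw [hb]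
    exact_mod_cast ha
  calc (∑ u : Fin (L + 1) → Fin n, if IsDoubledClosedWalk u then ρ ^ (vertexCount u - 1) else 0)
      ≤ ∑ u : Fin (L + 1) → Fin n, ∑ w : Fin (L + 1) → Fin r,
        (if IsDoubledClosedWalk u then ρ ^ (vertexCount u - 1) / D (vertexCount u) else 0) *
          (if SameShape u w then (1 : ℝ) else 0) := by
        refine Finset.sum_le_sum fun u _ => ?_
        rw [← Finset.mul_sum]
        split_ifs
        · calc ρ ^ (vertexCount u - 1) =
              ρ ^ (vertexCount u - 1) / D (vertexCount u) * D (vertexCount u) := by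
                rw [div_mul_cancel₀ _ (hD _).ne']
            _ ≤ _ := mul_le_mul_of_nonneg_left (h1 u) (div_nonneg (by positivity) (hD _).le)
        · simp
    -- Double counting of pairs of walks with the same shape: the weight depends only on the shape,
    -- so it may be read off either walk.
    _ = ∑ w : Fin (L + 1) → Fin r, ∑ u : Fin (L + 1) → Fin n,
        (if IsDoubledClosedWalk w then ρ ^ (vertexCount w - 1) / D (vertexCount w) else 0) *
          (if SameShape u w then (1 : ℝ) else 0) := by
        rw [Finset.sum_comm]
        refine Finset.sum_congr rfl fun w _ => Finset.sum_congr rfl fun u _ => ?_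
        by_cases h : SameShape u w
        · simp only [h.isDoubledClosedWalk_iff, h.vertexCount_eq]
        · simp [h]
    _ ≤ ∑ w : Fin (L + 1) → Fin r, (if IsDoubledClosedWalk w then (n : ℝ) else 0) := by
        refine Finset.sum_le_sum fun w _ => ?_
        rw [← Finset.mul_sum]
        split_ifs
        · refine (mul_le_mul_of_nonneg_left (h2 w) (div_nonneg (by positivity) (hD _).le)).trans ?_
          obtain ⟨v, hv⟩ : ∃ v, vertexCount w = v + 1 :=
            ⟨vertexCount w - 1, by have := vertexCount_pos w; omega⟩
          rw [hv, Nat.add_sub_cancel, div_mul_eq_mul_div, div_le_iff₀ (hD _)]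
          have hk1 : (1 : ℝ) ≤ k := by exact_mod_cast hk
          -- The weight has one factor `ρ` fewer than there are vertices, which leaves the single
          -- factor `n`.
          calc ρ ^ v * (n : ℝ) ^ (v + 1) = n * (n * ρ) ^ v := by rw [mul_pow]; ring
            _ ≤ n * (k : ℝ) ^ v := by gcongr
            _ ≤ n * (k : ℝ) ^ (v + 1) := by gcongr; simp
        · simp
    _ = _ := by
        rw [← Finset.sum_filter, Finset.sum_const, nsmul_eq_mul, mul_comm]

end Walks

/-! ### Moments of a symmetric random matrix with independent entries -/

/-- The unordered pair of two distinct nodes. -/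
def nodePair {n : ℕ} (i j : Fin n) (h : i ≠ j) : NodePair n :=
  if hlt : i < j then ⟨(i, j), hlt⟩ else ⟨(j, i), lt_of_le_of_ne (not_lt.mp hlt) h.symm⟩

theorem mk_nodePair {n : ℕ} (i j : Fin n) (h : i ≠ j) :
    s((nodePair i j h).1.1, (nodePair i j h).1.2) = s(i, j) := by
  unfold nodePair
  split_ifs
  · rfl
  · exact Sym2.eq_swap

theorem nodePair_eq_iff {n : ℕ} {i j i' j' : Fin n} (h : i ≠ j) (h' : i' ≠ j') :
    nodePair i j h = nodePair i' j' h' ↔ s(i, j) = s(i', j') := by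
  constructor
  · intro heq
    rw [← mk_nodePair i j h, ← mk_nodePair i' j' h', heq]
  · intro heq
    rw [← mk_nodePair i j h, ← mk_nodePair i' j' h'] at heq
    rcases Sym2.eq_iff.mp heq with ⟨h1, h2⟩ | ⟨h1, h2⟩
    · exact Subtype.ext (Prod.ext h1 h2)
    · have h3 := (nodePair i j h).2
      have h4 := (nodePair i' j' h').2
      rw [h1, h2] at h3
      exact absurd h3 h4.asymm

theorem nodePair_comm {n : ℕ} (i j : Fin n) (h : i ≠ j) :
    nodePair j i h.symm = nodePair i j h := (nodePair_eq_iff _ _).mpr Sym2.eq_swap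

/-! ### Expectations of products over independent edges -/

section Product

variable {E Ω : Type*} [Fintype E] [DecidableEq E] [MeasurableSpace Ω] (μ : E → Measure Ω)
  [∀ a, IsProbabilityMeasure (μ a)] {L : ℕ}

theorem integral_prod_comp_eval (e : Fin L → E) (f : Fin L → Ω → ℝ) :
    ∫ ω, ∏ t, f t (ω (e t)) ∂Measure.pi μ =
      ∏ a, ∫ x, ∏ t with e t = a, f t x ∂μ a := by
  rw [← integral_fintype_prod_eq_prod]
  congr 1
  ext ω
  rw [← Finset.prod_fiberwise (s := Finset.univ) (g := e)]
  refine Finset.prod_congr rfl fun a _ => Finset.prod_congr rfl fun t ht => ?_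
  rw [(Finset.mem_filter.mp ht).2]

/-- By independence the expectation factorises over edges, and an edge used only once contributes a
vanishing mean. -/
theorem integral_prod_comp_eval_eq_zero (e : Fin L → E) (f : Fin L → Ω → ℝ) (t : Fin L)
    (ht : ∀ t', t' ≠ t → e t' ≠ e t) (hf : ∫ x, f t x ∂μ (e t) = 0) :
    ∫ ω, ∏ t, f t (ω (e t)) ∂Measure.pi μ = 0 := by
  rw [integral_prod_comp_eval]
  refine Finset.prod_eq_zero (Finset.mem_univ (e t)) ?_
  have : (Finset.univ.filter fun t' => e t' = e t) = {t} := by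
    ext t'
    simp only [Finset.mem_filter, Finset.mem_univ, true_and, Finset.mem_singleton]
    exact ⟨fun h => by_contra fun hne => ht t' hne h, fun h => h ▸ rfl⟩
  simp only [this, Finset.prod_singleton, hf]

/-- For each distinct edge, one of its factors is bounded by `g`, of mean at most `ρ`, and the
remaining factors by one. Repeated visits therefore gain nothing, and only the number of distinct
edges enters. -/
theorem integral_prod_comp_eval_le (e : Fin L → E) (f : Fin L → Ω → ℝ) (g : E → Ω → ℝ)
    (hg : ∀ a, Integrable (g a) (μ a)) (hg1 : ∀ a x, g a x ≤ 1)
    (hfg : ∀ t x, |f t x| ≤ g (e t) x) {ρ : ℝ} (hρ : ∀ a, ∫ x, g a x ∂μ a ≤ ρ) :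
    ∫ ω, ∏ t, f t (ω (e t)) ∂Measure.pi μ ≤ ρ ^ (Finset.univ.image e).card := by
  rw [integral_prod_comp_eval]
  refine (le_abs_self _).trans ?_
  rw [Finset.abs_prod, ← Finset.prod_const, ← Finset.prod_subset (Finset.subset_univ
    (Finset.univ.image e))]
  · refine Finset.prod_le_prod (fun _ _ => abs_nonneg _) fun a ha => ?_
    obtain ⟨t, -, rfl⟩ := Finset.mem_image.mp ha
    refine le_trans (?_ : _ ≤ ∫ x, g (e t) x ∂μ (e t)) (hρ _)
    rw [← Real.norm_eq_abs]
    refine norm_integral_le_of_norm_le (hg (e t)) (ae_of_all _ fun x => ?_)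
    rw [Real.norm_eq_abs, Finset.abs_prod,
      ← Finset.mul_prod_erase (Finset.univ.filter fun t' => e t' = e t) _
        (Finset.mem_filter.mpr ⟨Finset.mem_univ t, rfl⟩)]
    refine (mul_le_of_le_one_right (abs_nonneg _) ?_).trans (hfg t x)
    exact Finset.prod_le_one (fun _ _ => abs_nonneg _) fun t' _ => (hfg t' x).trans (hg1 _ x)
  · intro a _ ha
    have : (Finset.univ.filter fun t => e t = a) = ∅ := by
      ext t
      simp only [Finset.mem_filter, Finset.mem_univ, true_and, Finset.notMem_empty, iff_false]
      exact fun h => ha (h ▸ Finset.mem_image_of_mem _ (Finset.mem_univ _))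
    simp [this]

end Product

/-! ### Expected traces of powers of a random block matrix -/

section Trace

variable {n d : ℕ} {Ω : Type*} [MeasurableSpace Ω]

/-- The block matrix with zero diagonal blocks whose `(x, y)` entry is a function of the
variable attached to the pair of nodes of `x` and `y`. -/
def edgeMatrix (φ : Fin n × Fin d → Fin n × Fin d → Ω → ℝ) (ω : NodePair n → Ω) :
    Matrix (Fin n × Fin d) (Fin n × Fin d) ℝ :=
  Matrix.of fun x y => if h : x.1 = y.1 then 0 else φ x y (ω (nodePair x.1 y.1 h))

variable {φ : Fin n × Fin d → Fin n × Fin d → Ω → ℝ} {g : NodePair n → Ω → ℝ}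

theorem measurable_edgeMatrix (hφ : ∀ x y, Measurable (φ x y)) (x y : Fin n × Fin d) :
    Measurable fun ω : NodePair n → Ω => edgeMatrix φ ω x y := by
  simp only [edgeMatrix, Matrix.of_apply]
  split_ifs with h
  · exact measurable_const
  · exact (hφ x y).comp (measurable_pi_apply _)

omit [MeasurableSpace Ω] in
theorem abs_edgeMatrix_le_one (hg1 : ∀ a x, g a x ≤ 1)
    (hφg : ∀ x y (h : x.1 ≠ y.1) a, |φ x y a| ≤ g (nodePair x.1 y.1 h) a) (ω : NodePair n → Ω)
    (x y : Fin n × Fin d) : |edgeMatrix φ ω x y| ≤ 1 := by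
  simp only [edgeMatrix, Matrix.of_apply]
  split_ifs with h
  · simp
  · exact (hφg x y h _).trans (hg1 _ _)

theorem integrable_walk_edgeMatrix (μ : NodePair n → Measure Ω) [∀ a, IsProbabilityMeasure (μ a)]
    (hφ : ∀ x y, Measurable (φ x y)) (hg1 : ∀ a x, g a x ≤ 1)
    (hφg : ∀ x y (h : x.1 ≠ y.1) a, |φ x y a| ≤ g (nodePair x.1 y.1 h) a) {L : ℕ}
    (w : Fin (L + 1) → Fin n × Fin d) :
    Integrable (fun ω => if w 0 = w (Fin.last L) then
      ∏ t : Fin L, edgeMatrix φ ω (w t.castSucc) (w t.succ) else 0) (Measure.pi μ) := by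
  split_ifs
  · refine Integrable.of_bound (C := 1) (Finset.measurable_prod _ fun t _ =>
      measurable_edgeMatrix hφ _ _).aestronglyMeasurable (ae_of_all _ fun ω => ?_)
    rw [Real.norm_eq_abs, Finset.abs_prod]
    exact Finset.prod_le_one (fun _ _ => abs_nonneg _)
      fun t _ => abs_edgeMatrix_le_one hg1 hφg ω _ _
  · exact integrable_const _

theorem integrable_trace_pow_edgeMatrix (μ : NodePair n → Measure Ω)
    [∀ a, IsProbabilityMeasure (μ a)]
    (hφ : ∀ x y, Measurable (φ x y)) (hg1 : ∀ a x, g a x ≤ 1)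
    (hφg : ∀ x y (h : x.1 ≠ y.1) a, |φ x y a| ≤ g (nodePair x.1 y.1 h) a) (L : ℕ) :
    Integrable (fun ω => ((edgeMatrix φ ω) ^ L).trace) (Measure.pi μ) := by
  simp only [matrix_trace_pow_eq_sum_walks]
  exact integrable_finsetSum _ fun w _ => integrable_walk_edgeMatrix μ hφ hg1 hφg w

-- Loops meet a zero diagonal block and simple edges a zero mean. In the remaining case there are at
-- least `v - 1` distinct edges for `v` nodes, and `ρ ≤ 1` allows the exponent to be lowered to `v -
-- 1`.
open Classical in
theorem integral_walk_edgeMatrix_le (μ : NodePair n → Measure Ω) [∀ a, IsProbabilityMeasure (μ a)]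
    (hg : ∀ a, Integrable (g a) (μ a)) (hg1 : ∀ a x, g a x ≤ 1)
    (hφg : ∀ x y (h : x.1 ≠ y.1) a, |φ x y a| ≤ g (nodePair x.1 y.1 h) a)
    (hφ0 : ∀ x y (h : x.1 ≠ y.1), ∫ a, φ x y a ∂μ (nodePair x.1 y.1 h) = 0)
    {ρ : ℝ} (hρ0 : 0 ≤ ρ) (hρ1 : ρ ≤ 1) (hρ : ∀ a, ∫ x, g a x ∂μ a ≤ ρ) {L : ℕ}
    (w : Fin (L + 1) → Fin n × Fin d) :
    ∫ ω, (if w 0 = w (Fin.last L) then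
      ∏ t : Fin L, edgeMatrix φ ω (w t.castSucc) (w t.succ) else 0) ∂Measure.pi μ ≤
      if IsDoubledClosedWalk (fun a => (w a).1)
        then ρ ^ (vertexCount (fun a => (w a).1) - 1) else 0 := by
  have hnn : (0 : ℝ) ≤ if IsDoubledClosedWalk (fun a => (w a).1)
        then ρ ^ (vertexCount (fun a => (w a).1) - 1) else 0 := by
    split_ifs <;> positivity
  by_cases hclosed : w 0 = w (Fin.last L)
  swap
  · simpa only [hclosed, if_false, integral_zero] using hnn
  simp only [hclosed, if_true]
  by_cases hloop : ∀ t : Fin L, (w t.castSucc).1 ≠ (w t.succ).1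
  swap
  · push Not at hloop
    obtain ⟨t, ht⟩ := hloop
    have : ∀ ω : NodePair n → Ω,
        ∏ t : Fin L, edgeMatrix φ ω (w t.castSucc) (w t.succ) = 0 := fun ω =>
      Finset.prod_eq_zero (Finset.mem_univ t) (by simp [edgeMatrix, ht])
    simpa only [this, integral_zero] using hnn
  let e : Fin L → NodePair n := fun t => nodePair _ _ (hloop t)
  let f : Fin L → Ω → ℝ := fun t => φ (w t.castSucc) (w t.succ)
  have hprod : ∀ ω : NodePair n → Ω, ∏ t : Fin L, edgeMatrix φ ω (w t.castSucc) (w t.succ) =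
      ∏ t, f t (ω (e t)) := fun ω =>
    Finset.prod_congr rfl fun t _ => by simp [edgeMatrix, hloop t, e, f]
  simp only [hprod]
  by_cases hdouble : ∀ t, ∃ t', t' ≠ t ∧ e t' = e t
  · have hgood : IsDoubledClosedWalk (fun a => (w a).1) := by
      refine ⟨congrArg Prod.fst hclosed, hloop, fun t => ?_⟩
      obtain ⟨t', hne, ht'⟩ := hdouble t
      exact ⟨t', hne, (nodePair_eq_iff _ _).mp ht'⟩
    rw [if_pos hgood]
    refine (integral_prod_comp_eval_le μ e f g hg hg1 (fun t x => hφg _ _ _ _) hρ).trans ?_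
    refine pow_le_pow_of_le_one hρ0 hρ1 ?_
    have h1 := vertexCount_le_card_edges_add_one fun a => (w a).1
    have h2 : (Finset.univ.image fun t : Fin L => s((w t.castSucc).1, (w t.succ).1)).card ≤
        (Finset.univ.image e).card := by
      have : (Finset.univ.image fun t : Fin L => s((w t.castSucc).1, (w t.succ).1)) =
          (Finset.univ.image e).image fun a => s(a.1.1, a.1.2) := by
        rw [Finset.image_image]
        refine Finset.image_congr fun t _ => ?_
        exact (mk_nodePair _ _ (hloop t)).symm
      rw [this]
      exact Finset.card_image_le
    omega
  · push Not at hdouble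
    obtain ⟨t, ht⟩ := hdouble
    rw [integral_prod_comp_eval_eq_zero μ e f t ht (hφ0 _ _ _)]
    exact hnn

open Classical in
theorem integral_trace_pow_edgeMatrix_le (μ : NodePair n → Measure Ω)
    [∀ a, IsProbabilityMeasure (μ a)] (hφ : ∀ x y, Measurable (φ x y))
    (hg : ∀ a, Integrable (g a) (μ a)) (hg1 : ∀ a x, g a x ≤ 1)
    (hφg : ∀ x y (h : x.1 ≠ y.1) a, |φ x y a| ≤ g (nodePair x.1 y.1 h) a)
    (hφ0 : ∀ x y (h : x.1 ≠ y.1), ∫ a, φ x y a ∂μ (nodePair x.1 y.1 h) = 0)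
    {ρ : ℝ} (hρ0 : 0 ≤ ρ) (hρ1 : ρ ≤ 1) (hρ : ∀ a, ∫ x, g a x ∂μ a ≤ ρ) (L : ℕ) :
    ∫ ω, ((edgeMatrix φ ω) ^ L).trace ∂Measure.pi μ ≤
      d ^ (L + 1) * ∑ u : Fin (L + 1) → Fin n,
        if IsDoubledClosedWalk u then ρ ^ (vertexCount u - 1) else 0 := by
  simp only [matrix_trace_pow_eq_sum_walks]
  rw [integral_finsetSum _ fun w _ => integrable_walk_edgeMatrix μ hφ hg1 hφg w]
  refine (Finset.sum_le_sum fun w _ =>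
    integral_walk_edgeMatrix_le μ hg hg1 hφg hφ0 hρ0 hρ1 hρ w).trans_eq ?_
  -- The bound sees only the node components of the walk, so the inner indices contribute a factor
  -- `d ^ (L + 1)`.
  refine (Fintype.sum_equiv (Equiv.arrowProdEquivProdArrow (Fin (L + 1)) (fun _ => Fin n)
    (fun _ => Fin d)) _ (fun p : (Fin (L + 1) → Fin n) × (Fin (L + 1) → Fin d) =>
      if IsDoubledClosedWalk p.1 then ρ ^ (vertexCount p.1 - 1) else 0) fun w => rfl).trans ?_
  rw [Fintype.sum_prod_type]
  simp [Finset.mul_sum]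

end Trace

/-! ### The comparison matrix -/

/-- The centred random variable with values `2` and `-1`. -/
def skewSign (b : Bool) : ℝ := if b then 2 else -1

/-- The distribution under which `skewSign` is centred. -/
noncomputable def skewMeasure : Measure Bool :=
  bernoulliMeasure true false ⟨1 / 3, by norm_num, by norm_num⟩

instance : IsProbabilityMeasure skewMeasure := by unfold skewMeasure; infer_instance

theorem integral_skewMeasure (f : Bool → ℝ) :
    ∫ b, f b ∂skewMeasure = 1 / 3 * f true + 2 / 3 * f false := by
  rw [skewMeasure, integral_bernoulliMeasure]
  norm_num

theorem integral_skewSign : ∫ b, skewSign b ∂skewMeasure = 0 := by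
  rw [integral_skewMeasure]; norm_num [skewSign]

theorem integral_skewSign_pow_nonneg (j : ℕ) : 0 ≤ ∫ b, skewSign b ^ j ∂skewMeasure := by
  rw [integral_skewMeasure]
  have h1 : (1 : ℝ) ≤ 2 ^ j := one_le_pow₀ (by norm_num)
  rcases j with _ | j
  · norm_num
  have h2 : (2 : ℝ) ≤ 2 ^ (j + 1) := by
    rw [pow_succ]; linarith [one_le_pow₀ (n := j) (by norm_num : (1 : ℝ) ≤ 2)]
  rcases neg_one_pow_eq_or ℝ (j + 1) with h | h <;> norm_num [skewSign, h] <;>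
    linarith

/-- This is why the entries are skewed: under symmetric signs all odd moments vanish, and doubled
walks with an edge traversed three times would not be counted. -/
theorem one_le_integral_skewSign_pow {j : ℕ} (hj : j ≠ 1) :
    1 ≤ ∫ b, skewSign b ^ j ∂skewMeasure := by
  rw [integral_skewMeasure]
  rcases j with _ | _ | _ | j
  · norm_num
  · exact absurd rfl hj
  · norm_num [skewSign]
  have h2 : (8 : ℝ) ≤ 2 ^ (j + 3) := by
    rw [pow_add]; linarith [one_le_pow₀ (n := j) (by norm_num : (1 : ℝ) ≤ 2)]
  rcases neg_one_pow_eq_or ℝ (j + 3) with h | h <;> norm_num [skewSign, h] <;> linarith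

/-- Hoeffding's lemma on an interval of length 3, with variance proxy `(3 / 2) ^ 2`. -/
theorem integral_exp_skewSign_le (s : ℝ) :
    ∫ b, Real.exp (s * skewSign b) ∂skewMeasure ≤ Real.exp (9 / 8 * s ^ 2) := by
  have h := hasSubgaussianMGF_of_mem_Icc_of_integral_eq_zero (μ := skewMeasure) (X := skewSign)
    (a := -1) (b := 2) (Measurable.of_discrete).aemeasurable
    (ae_of_all _ fun b => by cases b <;> norm_num [skewSign]) integral_skewSign
  refine (h.mgf_le s).trans_eq ?_
  congr 1
  norm_num [NNReal.coe_pow, NNReal.coe_div]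
  ring

/-- The symmetric matrix with zero diagonal and independent entries `skewSign` off it. -/
noncomputable def comparisonMatrix (r : ℕ) (ω : NodePair r → Bool) : Matrix (Fin r) (Fin r) ℝ :=
  Matrix.of fun i j => if h : i = j then 0 else skewSign (ω (nodePair i j h))

/-- The expectation factorises into moments of `skewSign`, all nonnegative. On a doubled walk no
multiplicity equals one, so every factor is at least one, including those of unvisited edges, where
the exponent is zero. -/
theorem integral_walk_comparisonMatrix_ge {r L : ℕ} [DecidablePred (IsDoubledClosedWalk
    (L := L) (α := Fin r))] (w : Fin (L + 1) → Fin r) :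
    (if IsDoubledClosedWalk w then (1 : ℝ) else 0) ≤
      ∫ ω, (if w 0 = w (Fin.last L) then
        ∏ t : Fin L, comparisonMatrix r ω (w t.castSucc) (w t.succ) else 0)
        ∂Measure.pi fun _ => skewMeasure := by
  by_cases hclosed : w 0 = w (Fin.last L)
  swap
  · have : ¬ IsDoubledClosedWalk w := fun h => hclosed h.1
    simp [hclosed, this]
  by_cases hloop : ∀ t : Fin L, w t.castSucc ≠ w t.succ
  swap
  · have hnot : ¬ IsDoubledClosedWalk w := fun h => hloop h.2.1
    push Not at hloop
    obtain ⟨t, ht⟩ := hloop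
    have : ∀ ω : NodePair r → Bool,
        ∏ t : Fin L, comparisonMatrix r ω (w t.castSucc) (w t.succ) = 0 := fun ω =>
      Finset.prod_eq_zero (Finset.mem_univ t) (by simp [comparisonMatrix, ht])
    simp [this, hnot]
  let e : Fin L → NodePair r := fun t => nodePair _ _ (hloop t)
  have hprod : ∀ ω : NodePair r → Bool,
      ∏ t : Fin L, comparisonMatrix r ω (w t.castSucc) (w t.succ) =
      ∏ t, (fun _ => skewSign) t (ω (e t)) := fun ω =>
    Finset.prod_congr rfl fun t _ => by simp [comparisonMatrix, hloop t, e]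
  simp only [hclosed, if_true, hprod]
  rw [integral_prod_comp_eval (fun _ => skewMeasure) e fun _ => skewSign]
  simp only [Finset.prod_const]
  split_ifs with hw
  · rw [← Finset.prod_const_one (s := (Finset.univ : Finset (NodePair r)))]
    refine Finset.prod_le_prod (fun _ _ => zero_le_one) fun a _ =>
      one_le_integral_skewSign_pow fun hone => ?_
    obtain ⟨t, ht⟩ := Finset.card_eq_one.mp hone
    have hta : e t = a := by
      have : t ∈ Finset.univ.filter fun t => e t = a := ht ▸ Finset.mem_singleton_self t
      exact (Finset.mem_filter.mp this).2
    obtain ⟨t', hne, ht'⟩ := hw.2.2 t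
    have : t' ∈ Finset.univ.filter fun t => e t = a := by
      refine Finset.mem_filter.mpr ⟨Finset.mem_univ _, ?_⟩
      rw [← hta]
      exact (nodePair_eq_iff _ _).mpr ht'
    rw [ht] at this
    exact hne (Finset.mem_singleton.mp this)
  · exact Finset.prod_nonneg fun a _ => integral_skewSign_pow_nonneg _

-- The moment method read backwards: a trace moment bounds a number of walks.
open Classical in
theorem card_doubledClosedWalk_le_integral_trace (r L : ℕ) :
    ((Finset.univ.filter fun w : Fin (L + 1) → Fin r => IsDoubledClosedWalk w).card : ℝ) ≤
      ∫ ω, ((comparisonMatrix r ω) ^ L).trace ∂Measure.pi fun _ => skewMeasure := by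
  simp only [matrix_trace_pow_eq_sum_walks]
  rw [integral_finsetSum _ fun w _ => Integrable.of_finite, Finset.natCast_card_filter]
  exact Finset.sum_le_sum fun w _ => integral_walk_comparisonMatrix_ge w

/-! ### Moments of bilinear forms of the comparison matrix -/

theorem sum_nodePair_add_swap {r : ℕ} (F : Fin r → Fin r → ℝ) (hF : ∀ i, F i i = 0) :
    ∑ a : NodePair r, (F a.1.1 a.1.2 + F a.1.2 a.1.1) = ∑ i, ∑ j, F i j := by
  have h1 : ∑ a : NodePair r, (F a.1.1 a.1.2 + F a.1.2 a.1.1) =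
      ∑ i, ∑ j, if i < j then F i j + F j i else 0 := by
    rw [← Fintype.sum_prod_type' (fun i j : Fin r => if i < j then F i j + F j i else 0),
      ← Finset.sum_filter]
    exact (Finset.sum_subtype _ (by simp) fun a : Fin r × Fin r =>
      F a.1 a.2 + F a.2 a.1).symm
  have h2 : ∑ i, ∑ j, (if i < j then F j i else 0) = ∑ i, ∑ j, if j < i then F i j else 0 :=
    Finset.sum_comm
  have h3 : ∀ i j, F i j = (if i < j then F i j else 0) + if j < i then F i j else 0 := by
    intro i j
    rcases lt_trichotomy i j with h | rfl | h
    · simp [h, h.asymm]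
    · simp [hF]
    · simp [h, h.asymm]
  have h4 : ∀ i j, (if i < j then F i j + F j i else 0) =
      (if i < j then F i j else 0) + if i < j then F j i else 0 := by
    intro i j; split_ifs <;> simp
  rw [h1]
  simp only [h4, Finset.sum_add_distrib, h2]
  simp only [← Finset.sum_add_distrib, ← h3]

theorem bilin_comparisonMatrix {r : ℕ} (x y : Fin r → ℝ) (ω : NodePair r → Bool) :
    ∑ i, ∑ j, x i * comparisonMatrix r ω i j * y j =
      ∑ a : NodePair r, (x a.1.1 * y a.1.2 + x a.1.2 * y a.1.1) * skewSign (ω a) := by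
  rw [← sum_nodePair_add_swap _ fun i => by simp [comparisonMatrix]]
  refine Finset.sum_congr rfl fun a _ => ?_
  have h1 : nodePair a.1.1 a.1.2 a.2.ne = a := by simp [nodePair, a.2]
  have h2 : nodePair a.1.2 a.1.1 a.2.ne' = a := (nodePair_comm _ _ a.2.ne).trans h1
  simp only [comparisonMatrix, Matrix.of_apply, a.2.ne, a.2.ne', dif_neg, not_false_eq_true, h1, h2]
  ring

theorem sum_nodePair_sq_le {r : ℕ} (x y : Fin r → ℝ) (hx : ∑ i, x i ^ 2 ≤ 1)
    (hy : ∑ i, y i ^ 2 ≤ 1) :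
    ∑ a : NodePair r, (x a.1.1 * y a.1.2 + x a.1.2 * y a.1.1) ^ 2 ≤ 2 := by
  let F : Fin r → Fin r → ℝ := fun i j => if i = j then 0 else 2 * (x i ^ 2 * y j ^ 2)
  calc ∑ a : NodePair r, (x a.1.1 * y a.1.2 + x a.1.2 * y a.1.1) ^ 2
      ≤ ∑ a : NodePair r, (F a.1.1 a.1.2 + F a.1.2 a.1.1) := by
        refine Finset.sum_le_sum fun a _ => ?_
        simp only [F, a.2.ne, a.2.ne', if_false]
        nlinarith [sq_nonneg (x a.1.1 * y a.1.2 - x a.1.2 * y a.1.1)]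
    _ = ∑ i, ∑ j, F i j := sum_nodePair_add_swap F fun i => by simp [F]
    _ ≤ ∑ i, ∑ j, 2 * (x i ^ 2 * y j ^ 2) := by
        refine Finset.sum_le_sum fun i _ => Finset.sum_le_sum fun j _ => ?_
        simp only [F]
        split_ifs
        · positivity
        · exact le_rfl
    _ = 2 * ((∑ i, x i ^ 2) * ∑ j, y j ^ 2) := by
        rw [Finset.sum_mul_sum, Finset.mul_sum]
        simp only [Finset.mul_sum]
    _ ≤ 2 * (1 * 1) := by gcongr
    _ = 2 := by norm_num

theorem integral_exp_sum_skewSign_le {r : ℕ} (c : NodePair r → ℝ) (s : ℝ) (hc : ∑ a, c a ^ 2 ≤ 2) :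
    ∫ ω, Real.exp (s * ∑ a, c a * skewSign (ω a)) ∂(Measure.pi fun _ : NodePair r => skewMeasure)
      ≤ Real.exp (9 / 4 * s ^ 2) := by
  have h1 : ∀ ω : NodePair r → Bool, Real.exp (s * ∑ a, c a * skewSign (ω a)) =
      ∏ a, Real.exp (s * c a * skewSign (ω a)) := fun ω => by
    rw [← Real.exp_sum, Finset.mul_sum]
    simp only [mul_assoc]
  simp only [h1]
  rw [integral_fintype_prod_eq_prod (f := fun a b => Real.exp (s * c a * skewSign b))]
  calc ∏ a, ∫ b, Real.exp (s * c a * skewSign b) ∂skewMeasure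
      ≤ ∏ a, Real.exp (9 / 8 * (s * c a) ^ 2) :=
        Finset.prod_le_prod (fun a _ => integral_nonneg fun b => (Real.exp_pos _).le)
          fun a _ => integral_exp_skewSign_le _
    _ = Real.exp (9 / 8 * s ^ 2 * ∑ a, c a ^ 2) := by
        rw [← Real.exp_sum, Finset.mul_sum]
        congr 1
        exact Finset.sum_congr rfl fun a _ => by ring
    _ ≤ Real.exp (9 / 4 * s ^ 2) := by
        refine Real.exp_le_exp.mpr ?_
        nlinarith [mul_le_mul_of_nonneg_left hc (sq_nonneg s)]

theorem pow_two_mul_le_factorial_mul_exp (z : ℝ) (k : ℕ) :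
    z ^ (2 * k) ≤ (2 * k).factorial * (Real.exp z + Real.exp (-z)) := by
  have h1 := Real.pow_div_factorial_le_exp |z| (abs_nonneg z) (2 * k)
  rw [(even_two_mul k).pow_abs, div_le_iff₀ (by positivity)] at h1
  have h2 : Real.exp |z| ≤ Real.exp z + Real.exp (-z) := by
    rcases abs_choice z with h | h <;> rw [h] <;> linarith [Real.exp_pos z, Real.exp_pos (-z)]
  calc z ^ (2 * k) ≤ Real.exp |z| * (2 * k).factorial := h1
    _ ≤ (Real.exp z + Real.exp (-z)) * (2 * k).factorial := by gcongr
    _ = _ := mul_comm _ _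

theorem exp_nine_quarters_le : Real.exp (9 / 4) ≤ 16 := by
  have h : Real.exp (9 / 4) ≤ Real.exp 1 ^ (5 / 2 : ℝ) := by
    rw [← Real.exp_mul]; exact Real.exp_le_exp.mpr (by norm_num)
  refine h.trans ?_
  calc Real.exp 1 ^ (5 / 2 : ℝ) ≤ 3 ^ (5 / 2 : ℝ) := by
        gcongr; linarith [Real.exp_one_lt_d9]
    _ = √(3 ^ 5) := by rw [Real.sqrt_eq_rpow, ← Real.rpow_natCast, ← Real.rpow_mul] <;> norm_num
    _ ≤ 16 := by rw [Real.sqrt_le_left] <;> norm_num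

/-- The moment is extracted from the exponential moments at `±s` with `s = √k`, where the
sub-Gaussian factor is only exponential in `k`. Dividing `(2k)! ≤ 4 ^ k * k ^ (2k)` by `s ^ (2k) = k
^ k` leaves the order `k ^ k`. -/
theorem integral_pow_sum_skewSign_le {r : ℕ} (c : NodePair r → ℝ) {k : ℕ} (hk : 0 < k)
    (hc : ∑ a, c a ^ 2 ≤ 2) :
    ∫ ω, (∑ a, c a * skewSign (ω a)) ^ (2 * k) ∂(Measure.pi fun _ : NodePair r => skewMeasure)
      ≤ 2 * (64 * k) ^ k := by
  have hk0 : (0 : ℝ) < k := by exact_mod_cast hk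
  set s := √(k : ℝ) with hs
  have hs2 : s ^ 2 = k := Real.sq_sqrt hk0.le
  have hs2k : s ^ (2 * k) = (k : ℝ) ^ k := by rw [pow_mul, hs2]
  set Z : (NodePair r → Bool) → ℝ := fun ω => ∑ a, c a * skewSign (ω a) with hZ
  have hexp : Real.exp (9 / 4 * s ^ 2) ≤ 16 ^ k := by
    rw [hs2, mul_comm, Real.exp_nat_mul]
    exact pow_le_pow_left₀ (Real.exp_pos _).le exp_nine_quarters_le _
  have h1 : s ^ (2 * k) * ∫ ω, Z ω ^ (2 * k) ∂(Measure.pi fun _ : NodePair r => skewMeasure) ≤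
      (2 * k).factorial * (2 * 16 ^ k) := by
    rw [← integral_const_mul]
    calc ∫ ω, s ^ (2 * k) * Z ω ^ (2 * k) ∂(Measure.pi fun _ : NodePair r => skewMeasure)
        ≤ ∫ ω, (2 * k).factorial * (Real.exp (s * Z ω) + Real.exp (-s * Z ω))
          ∂(Measure.pi fun _ : NodePair r => skewMeasure) := by
          refine integral_mono Integrable.of_finite Integrable.of_finite fun ω => ?_
          have := pow_two_mul_le_factorial_mul_exp (s * Z ω) k
          rwa [mul_pow, ← neg_mul] at this
      _ = (2 * k).factorial * (∫ ω, Real.exp (s * Z ω) ∂(Measure.pi fun _ => skewMeasure) +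
          ∫ ω, Real.exp (-s * Z ω) ∂(Measure.pi fun _ => skewMeasure)) := by
          rw [integral_const_mul, integral_add Integrable.of_finite Integrable.of_finite]
      _ ≤ (2 * k).factorial * (16 ^ k + 16 ^ k) := by
          gcongr
          · exact (integral_exp_sum_skewSign_le c s hc).trans hexp
          · refine (integral_exp_sum_skewSign_le c (-s) hc).trans ?_
            rwa [neg_sq]
      _ = _ := by ring
  have hfac : ((2 * k).factorial : ℝ) ≤ 4 ^ k * ((k : ℝ) ^ k * (k : ℝ) ^ k) := by
    have : ((2 * k).factorial : ℝ) ≤ ((2 * k : ℕ) : ℝ) ^ (2 * k) := by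
      exact_mod_cast Nat.factorial_le_pow _
    refine this.trans_eq ?_
    push_cast
    rw [mul_pow, pow_mul, ← pow_add, two_mul]
    norm_num
  rw [hs2k] at h1
  have hkk : (0 : ℝ) < (k : ℝ) ^ k := by positivity
  refine le_of_mul_le_mul_left (h1.trans ?_) hkk
  calc ((2 * k).factorial : ℝ) * (2 * 16 ^ k)
      ≤ 4 ^ k * ((k : ℝ) ^ k * (k : ℝ) ^ k) * (2 * 16 ^ k) := by gcongr
    _ = (k : ℝ) ^ k * (2 * (64 * k) ^ k) := by
        rw [mul_pow, show (64 : ℝ) = 4 * 16 by norm_num, mul_pow]; ring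

/-- The trace is at most `r` times the norm, and the norm is controlled on pairs of net points. The
union over pairs costs `25 ^ r`, which is harmless when `r` is a multiple of `k`. -/
theorem integral_trace_pow_comparisonMatrix_le {r k : ℕ} (hk : 0 < k) :
    ∫ ω, ((comparisonMatrix r ω) ^ (2 * k)).trace ∂(Measure.pi fun _ => skewMeasure) ≤
      r * (16 ^ k * (25 ^ r * (2 * (64 * k) ^ k))) := by
  obtain ⟨N, hcard, hN1, hN⟩ := exists_half_net (EuclideanSpace ℝ (Fin r))
  rw [finrank_euclideanSpace, Fintype.card_fin] at hcard
  have hsq : ∀ x ∈ N, ∑ i, x i ^ 2 ≤ 1 := fun x hx => by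
    have h1 := EuclideanSpace.real_norm_sq_eq x
    rw [← h1]
    exact pow_le_one₀ (norm_nonneg _) (hN1 x hx)
  calc ∫ ω, ((comparisonMatrix r ω) ^ (2 * k)).trace ∂(Measure.pi fun _ => skewMeasure)
      ≤ ∫ ω, r * (16 ^ k * ∑ x ∈ N, ∑ y ∈ N,
        (∑ i, ∑ j, x i * comparisonMatrix r ω i j * y j) ^ (2 * k))
        ∂(Measure.pi fun _ => skewMeasure) := by
        refine integral_mono Integrable.of_finite Integrable.of_finite fun ω => ?_
        refine (trace_le_card_mul_opNorm _).trans ?_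
        rw [Fintype.card_fin]
        exact mul_le_mul_of_nonneg_left ((opNorm_pow_le _ (by omega)).trans
          (opNorm_pow_le_sum_of_half_net hN _ hk)) (Nat.cast_nonneg _)
    _ = r * (16 ^ k * ∑ x ∈ N, ∑ y ∈ N, ∫ ω,
        (∑ i, ∑ j, x i * comparisonMatrix r ω i j * y j) ^ (2 * k)
        ∂(Measure.pi fun _ => skewMeasure)) := by
        rw [integral_const_mul, integral_const_mul,
          integral_finsetSum _ fun _ _ => Integrable.of_finite]
        congr 2
        exact Finset.sum_congr rfl fun x _ => integral_finsetSum _ fun _ _ => Integrable.of_finite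
    _ ≤ r * (16 ^ k * ∑ x ∈ N, ∑ y ∈ N, (2 : ℝ) * (64 * (k : ℝ)) ^ k) := by
        refine mul_le_mul_of_nonneg_left (mul_le_mul_of_nonneg_left (Finset.sum_le_sum fun x hx =>
          Finset.sum_le_sum fun y hy => ?_) (by positivity)) (by positivity)
        simp only [bilin_comparisonMatrix]
        exact integral_pow_sum_skewSign_le _ hk (sum_nodePair_sq_le _ _ (hsq x hx) (hsq y hy))
    _ ≤ r * (16 ^ k * (25 ^ r * (2 * (64 * k) ^ k))) := by
        have h25 : (N.card : ℝ) * N.card ≤ 25 ^ r := by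
          have h5 : (N.card : ℝ) ≤ 5 ^ r := by exact_mod_cast hcard
          calc (N.card : ℝ) * N.card ≤ 5 ^ r * 5 ^ r := by gcongr
            _ = 25 ^ r := by rw [← mul_pow]; norm_num
        rw [Finset.sum_const, Finset.sum_const, nsmul_eq_mul, nsmul_eq_mul, ← mul_assoc (N.card : ℝ)]
        gcongr

open Classical in
theorem card_doubledClosedWalk_le {k : ℕ} (hk : 0 < k) :
    ((Finset.univ.filter fun w : Fin (2 * k + 1) → Fin (2 * k + k) =>
      IsDoubledClosedWalk w).card : ℝ) ≤ (10 ^ 9 * k) ^ k := by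
  refine (card_doubledClosedWalk_le_integral_trace _ _).trans
    ((integral_trace_pow_comparisonMatrix_le hk).trans ?_)
  have h1 : (((2 * k + k : ℕ) : ℝ)) * 2 ≤ 6 ^ k := by
    have : ∀ k : ℕ, 0 < k → 6 * k ≤ 6 ^ k := by
      intro k hk
      induction k, hk using Nat.le_induction with
      | base => norm_num
      | succ j hj ih => rw [pow_succ]; omega
    have h := this k hk
    have h' : (6 : ℝ) * k ≤ 6 ^ k := by exact_mod_cast h
    push_cast
    linarith
  calc ((2 * k + k : ℕ) : ℝ) * (16 ^ k * (25 ^ (2 * k + k) * (2 * (64 * k) ^ k)))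
      = (((2 * k + k : ℕ) : ℝ) * 2) * (16 ^ k * 25 ^ (3 * k) * (64 * k) ^ k) := by
        rw [show 2 * k + k = 3 * k by ring]; ring
    _ ≤ 6 ^ k * (16 ^ k * 25 ^ (3 * k) * (64 * k) ^ k) := by gcongr
    -- `6 * 16 * 25 ^ 3 * 64 = 96000000`.
    _ = (96000000 * k) ^ k := by
        rw [pow_mul, ← mul_pow, ← mul_pow, ← mul_pow]; norm_num [← mul_assoc]
    _ ≤ (10 ^ 9 * k) ^ k := by gcongr; norm_num

/-! ### Tail bound for the operator norm -/

section Tail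

variable {n d : ℕ} {Ω : Type*} [MeasurableSpace Ω]
  {φ : Fin n × Fin d → Fin n × Fin d → Ω → ℝ} {g : NodePair n → Ω → ℝ}

/-- Markov's inequality for the trace of the `2k`-th power, which dominates the `2k`-th power of the
norm; the walks have length `2k` and are compared with walks on `3k` nodes. -/
theorem measureReal_opNorm_edgeMatrix_mul_le (μ : NodePair n → Measure Ω)
    [∀ a, IsProbabilityMeasure (μ a)] (hφ : ∀ x y, Measurable (φ x y))
    (hsymm : ∀ ω, (edgeMatrix φ ω).transpose = edgeMatrix φ ω)
    (hg : ∀ a, Integrable (g a) (μ a)) (hg1 : ∀ a x, g a x ≤ 1)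
    (hφg : ∀ x y (h : x.1 ≠ y.1) a, |φ x y a| ≤ g (nodePair x.1 y.1 h) a)
    (hφ0 : ∀ x y (h : x.1 ≠ y.1), ∫ a, φ x y a ∂μ (nodePair x.1 y.1 h) = 0)
    {ρ : ℝ} (hρ0 : 0 ≤ ρ) (hρ1 : ρ ≤ 1) (hρ : ∀ a, ∫ x, g a x ∂μ a ≤ ρ)
    {k : ℕ} (hk : 0 < k) (hnρ : n * ρ ≤ k) {T : ℝ} (hT : 0 ≤ T) :
    T ^ (2 * k) * (Measure.pi μ).real {ω | T < opNorm (edgeMatrix φ ω)} ≤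
      d ^ (2 * k + 1) * (n * (10 ^ 9 * k) ^ k) := by
  classical
  have hle : ∀ ω, opNorm (edgeMatrix φ ω) ^ (2 * k) ≤ ((edgeMatrix φ ω) ^ (2 * k)).trace :=
    fun ω => opNorm_pow_two_mul_le_trace (hsymm ω) hk
  have hsub : {ω | T < opNorm (edgeMatrix φ ω)} ⊆
      {ω | T ^ (2 * k) ≤ ((edgeMatrix φ ω) ^ (2 * k)).trace} := fun ω (hω : T < _) =>
    (pow_le_pow_left₀ hT hω.le _).trans (hle ω)
  calc T ^ (2 * k) * (Measure.pi μ).real {ω | T < opNorm (edgeMatrix φ ω)}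
      ≤ T ^ (2 * k) * (Measure.pi μ).real
        {ω | T ^ (2 * k) ≤ ((edgeMatrix φ ω) ^ (2 * k)).trace} := by
        gcongr
        exact measure_ne_top _ _
    _ ≤ ∫ ω, ((edgeMatrix φ ω) ^ (2 * k)).trace ∂Measure.pi μ :=
        mul_meas_ge_le_integral_of_nonneg
          (ae_of_all _ fun ω => (pow_nonneg (opNorm_nonneg _) _).trans (hle ω))
          (integrable_trace_pow_edgeMatrix μ hφ hg1 hφg _) _
    _ ≤ d ^ (2 * k + 1) * ∑ u : Fin (2 * k + 1) → Fin n,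
        (if IsDoubledClosedWalk u then ρ ^ (vertexCount u - 1) else 0) :=
        integral_trace_pow_edgeMatrix_le μ hφ hg hg1 hφg hφ0 hρ0 hρ1 hρ _
    _ ≤ d ^ (2 * k + 1) * (n * (10 ^ 9 * k) ^ k) := by
        gcongr
        refine (sum_doubledClosedWalk_le hρ0 hk hnρ rfl).trans ?_
        gcongr
        exact card_doubledClosedWalk_le hk

/-- In the threshold, `d ^ 3` absorbs `d ^ (2k + 1)` since `k ≥ 1`, and `10 ^ 9 * k` absorbs the
number of walks. The factor `e ^ 2` yields `e ^ (2k) ≥ n ^ 2`, which turns the remaining factor `n`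
into `1 / n`. -/
theorem measureReal_opNorm_edgeMatrix_le (hd : 0 < d) (hn : 0 < n) (μ : NodePair n → Measure Ω)
    [∀ a, IsProbabilityMeasure (μ a)] (hφ : ∀ x y, Measurable (φ x y))
    (hsymm : ∀ ω, (edgeMatrix φ ω).transpose = edgeMatrix φ ω)
    (hg : ∀ a, Integrable (g a) (μ a)) (hg1 : ∀ a x, g a x ≤ 1)
    (hφg : ∀ x y (h : x.1 ≠ y.1) a, |φ x y a| ≤ g (nodePair x.1 y.1 h) a)
    (hφ0 : ∀ x y (h : x.1 ≠ y.1), ∫ a, φ x y a ∂μ (nodePair x.1 y.1 h) = 0)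
    {ρ : ℝ} (hρ0 : 0 ≤ ρ) (hρ1 : ρ ≤ 1) (hρ : ∀ a, ∫ x, g a x ∂μ a ≤ ρ)
    {k : ℕ} (hk : 0 < k) (hnρ : n * ρ ≤ k) (hlog : Real.log n ≤ k) :
    (Measure.pi μ).real {ω | √(d ^ 3 * 10 ^ 9 * Real.exp 2 * k) < opNorm (edgeMatrix φ ω)} ≤
      (n : ℝ)⁻¹ := by
  have hk0 : (0 : ℝ) < k := by exact_mod_cast hk
  have hd1 : (1 : ℝ) ≤ d := by exact_mod_cast hd
  have hn0 : (0 : ℝ) < n := by exact_mod_cast hn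
  have h := measureReal_opNorm_edgeMatrix_mul_le μ hφ hsymm hg hg1 hφg hφ0 hρ0 hρ1 hρ hk hnρ
    (Real.sqrt_nonneg (d ^ 3 * 10 ^ 9 * Real.exp 2 * k))
  set P := (Measure.pi μ).real
    {ω | √(d ^ 3 * 10 ^ 9 * Real.exp 2 * k) < opNorm (edgeMatrix φ ω)} with hP
  have hP0 : 0 ≤ P := measureReal_nonneg
  rw [pow_mul, Real.sq_sqrt (by positivity)] at h
  have hexp : (n : ℝ) * n ≤ Real.exp 2 ^ k := by
    rw [← Real.exp_nat_mul]
    calc (n : ℝ) * n = Real.exp (Real.log n + Real.log n) := by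
          rw [Real.exp_add, Real.exp_log hn0]
      _ ≤ _ := Real.exp_le_exp.mpr (by linarith)
  have hdk : (d : ℝ) ^ (2 * k + 1) ≤ (d ^ 3) ^ k := by
    rw [← pow_mul]
    exact pow_le_pow_right₀ hd1 (by omega)
  have hM : (0 : ℝ) < (d ^ 3) ^ k * (10 ^ 9 * k) ^ k := by positivity
  have h2 : ((d : ℝ) ^ 3) ^ k * (10 ^ 9 * k) ^ k * ((n * n) * P) ≤
      (d ^ 3) ^ k * (10 ^ 9 * k) ^ k * n := by
    calc ((d : ℝ) ^ 3) ^ k * (10 ^ 9 * k) ^ k * ((n * n) * P)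
        ≤ (d ^ 3) ^ k * (10 ^ 9 * k) ^ k * (Real.exp 2 ^ k * P) := by gcongr
      _ = (d ^ 3 * 10 ^ 9 * Real.exp 2 * k) ^ k * P := by simp only [mul_pow]; ring
      _ ≤ d ^ (2 * k + 1) * (n * (10 ^ 9 * k) ^ k) := h
      _ ≤ (d ^ 3) ^ k * (n * (10 ^ 9 * k) ^ k) := by gcongr
      _ = _ := by ring
  have h3 := le_of_mul_le_mul_left h2 hM
  rw [mul_assoc] at h3
  have h4 : n * P ≤ 1 := le_of_mul_le_mul_left (by linarith) hn0
  rw [← one_div, le_div_iff₀ hn0]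
  linarith

end Tail

/-! ### The uniform distribution is centred -/

section Group

variable {d : ℕ} {𝒢 : GroupKind}

theorem SyncGroup.mat_mul (Q S : SyncGroup d 𝒢) : (Q * S).mat = Q.mat * S.mat := rfl

theorem SyncGroup.mat_mul_transpose (Q : SyncGroup d 𝒢) : Q.mat * Q.mat.transpose = 1 :=
  (Matrix.mem_orthogonalGroup_iff (Fin d) ℝ).mp Q.1.2

theorem SyncGroup.abs_mat_le_one (Q : SyncGroup d 𝒢) (a b : Fin d) : |Q.mat a b| ≤ 1 :=
  entry_norm_bound_of_unitary (𝕜 := ℝ) Q.1.2 a b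

theorem SyncGroup.abs_mat_mul_transpose_le_one (Q S : SyncGroup d 𝒢) (a b : Fin d) :
    |(Q.mat * S.mat.transpose) a b| ≤ 1 :=
  (Q * S⁻¹).abs_mat_le_one a b

theorem SyncGroup.measurable_mat (a b : Fin d) :
    Measurable fun Q : SyncGroup d 𝒢 => Q.mat a b := by
  have h1 : Continuous fun Q : SyncGroup d 𝒢 => (Q : Matrix.orthogonalGroup (Fin d) ℝ) :=
    continuous_subtype_val
  have h2 : Continuous fun Q : Matrix.orthogonalGroup (Fin d) ℝ =>
      (Q : Matrix (Fin d) (Fin d) ℝ) := continuous_subtype_val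
  exact ((continuous_apply_apply a b).comp (h2.comp h1)).measurable

/-- The diagonal matrix with entries `-1` on `s` and `1` off `s`. -/
def flipMatrix (s : Finset (Fin d)) : Matrix (Fin d) (Fin d) ℝ :=
  Matrix.diagonal fun a => if a ∈ s then -1 else 1

theorem flipMatrix_mem_orthogonalGroup (s : Finset (Fin d)) :
    flipMatrix s ∈ Matrix.orthogonalGroup (Fin d) ℝ := by
  rw [Matrix.mem_orthogonalGroup_iff, flipMatrix, Matrix.diagonal_transpose,
    Matrix.diagonal_mul_diagonal, ← Matrix.diagonal_one]
  congr 1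
  ext a
  split_ifs <;> norm_num

/-- A diagonal sign matrix negates row `a`. In the rotation group a second sign must change to keep
the determinant one, hence `2 ≤ d`. -/
theorem exists_syncGroup_flip (h𝒢 : 𝒢 = GroupKind.special → 2 ≤ d) (a : Fin d) :
    ∃ Q : SyncGroup d 𝒢, ∀ (S : SyncGroup d 𝒢) (b : Fin d), (Q * S).mat a b = -S.mat a b := by
  suffices h : ∃ s : Finset (Fin d), a ∈ s ∧
      (⟨flipMatrix s, flipMatrix_mem_orthogonalGroup s⟩ : Matrix.orthogonalGroup (Fin d) ℝ) ∈
        syncSubgroup d 𝒢 by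
    obtain ⟨s, has, hs⟩ := h
    refine ⟨⟨_, hs⟩, fun S b => ?_⟩
    rw [SyncGroup.mat_mul]
    change (flipMatrix s * S.mat) a b = _
    rw [flipMatrix, Matrix.diagonal_mul, if_pos has, neg_one_mul]
  cases 𝒢 with
  | orthogonal => exact ⟨{a}, Finset.mem_singleton_self a, Subgroup.mem_top _⟩
  | special =>
    have : Nontrivial (Fin d) := Fin.nontrivial_iff_two_le.mpr (h𝒢 rfl)
    obtain ⟨b, hb⟩ := exists_ne a
    refine ⟨{a, b}, by simp, ?_⟩
    change (flipMatrix {a, b}).det = 1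
    rw [flipMatrix, Matrix.det_diagonal, Finset.prod_ite_mem, Finset.univ_inter,
      Finset.prod_pair hb.symm]
    norm_num

/-- By left invariance under the flip of row `a`, the mean equals its own negative. -/
theorem integral_mat_unif (h𝒢 : 𝒢 = GroupKind.special → 2 ≤ d) (a b : Fin d) :
    ∫ Q : SyncGroup d 𝒢, Q.mat a b ∂unif d 𝒢 = 0 := by
  obtain ⟨Q, hQ⟩ := exists_syncGroup_flip h𝒢 a
  have : (unif d 𝒢).IsMulLeftInvariant := by unfold unif; infer_instance
  have h := integral_mul_left_eq_self (μ := unif d 𝒢) (fun S : SyncGroup d 𝒢 => S.mat a b) Q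
  simp only [hQ, integral_neg] at h
  linarith

end Group

/-! ### The centred observation matrix -/

section Model

variable {n K d : ℕ} {𝒢 : GroupKind}

/-- The indicator of an edge. -/
def edgeIndicator (b : Bool) : ℝ := if b then 1 else 0

/-- The centred block attached to a pair of nodes. -/
noncomputable def centredBlock (p : unitInterval) (C : Fin n → Fin K) (R : Fin n → SyncGroup d 𝒢)
    (i j : Fin n) (z : Bool × SyncGroup d 𝒢) : Matrix (Fin d) (Fin d) ℝ :=
  if C i = C j then (edgeIndicator z.1 - p) • ((R i).mat * (R j).mat.transpose)
  else edgeIndicator z.1 • z.2.mat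

/-- The entries of the centred observation matrix off the diagonal blocks. -/
noncomputable def centredEntry (p : unitInterval) (C : Fin n → Fin K) (R : Fin n → SyncGroup d 𝒢)
    (x y : Fin n × Fin d) (z : Bool × SyncGroup d 𝒢) : ℝ :=
  if x.1 < y.1 then centredBlock p C R x.1 y.1 z x.2 y.2
  else centredBlock p C R y.1 x.1 z y.2 x.2

/-- A bound for the entries of the centred block attached to a pair of nodes. -/
noncomputable def blockBound (p : unitInterval) (C : Fin n → Fin K) (a : NodePair n)
    (z : Bool × SyncGroup d 𝒢) : ℝ :=
  if C a.1.1 = C a.1.2 then |edgeIndicator z.1 - p| else edgeIndicator z.1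

/-- The distribution of the variable attached to a pair of nodes. -/
noncomputable def pairMeasure (p q : unitInterval) (C : Fin n → Fin K) (d : ℕ) (𝒢 : GroupKind)
    (a : NodePair n) : Measure (Bool × SyncGroup d 𝒢) :=
  (bernoulliMeasure true false (if C a.1.1 = C a.1.2 then p else q)).prod (unif d 𝒢)

instance isProbabilityMeasure_pairMeasure (p q : unitInterval) (C : Fin n → Fin K) (a : NodePair n) :
    IsProbabilityMeasure (pairMeasure p q C d 𝒢 a) := by
  unfold pairMeasure
  infer_instance

theorem measurable_comp_fst (f : Bool → ℝ) :
    Measurable fun z : Bool × SyncGroup d 𝒢 => f z.1 :=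
  (Measurable.of_discrete (f := f)).comp measurable_fst

theorem measurable_centredBlock (p : unitInterval) (C : Fin n → Fin K) (R : Fin n → SyncGroup d 𝒢)
    (i j : Fin n) (a b : Fin d) : Measurable fun z => centredBlock p C R i j z a b := by
  unfold centredBlock
  split_ifs
  · exact (measurable_comp_fst fun b => edgeIndicator b - p).mul_const _
  · exact (measurable_comp_fst edgeIndicator).mul
      ((SyncGroup.measurable_mat a b).comp measurable_snd)

theorem measurable_centredEntry (p : unitInterval) (C : Fin n → Fin K) (R : Fin n → SyncGroup d 𝒢)
    (x y : Fin n × Fin d) : Measurable (centredEntry p C R x y) := by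
  unfold centredEntry
  split_ifs <;> exact measurable_centredBlock _ _ _ _ _ _ _

theorem abs_edgeIndicator_sub_le_one (p : unitInterval) (b : Bool) :
    |edgeIndicator b - p| ≤ 1 := by
  have h0 := p.2.1
  have h1 := p.2.2
  cases b <;> rw [abs_le] <;> constructor <;> norm_num [edgeIndicator] <;> linarith

theorem edgeIndicator_nonneg (b : Bool) : 0 ≤ edgeIndicator b := by
  cases b <;> norm_num [edgeIndicator]

theorem edgeIndicator_le_one (b : Bool) : edgeIndicator b ≤ 1 := by
  cases b <;> norm_num [edgeIndicator]

theorem blockBound_le_one (p : unitInterval) (C : Fin n → Fin K) (a : NodePair n)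
    (z : Bool × SyncGroup d 𝒢) : blockBound p C a z ≤ 1 := by
  unfold blockBound
  split_ifs
  · exact abs_edgeIndicator_sub_le_one _ _
  · exact edgeIndicator_le_one _

theorem blockBound_nonneg (p : unitInterval) (C : Fin n → Fin K) (a : NodePair n)
    (z : Bool × SyncGroup d 𝒢) : 0 ≤ blockBound p C a z := by
  unfold blockBound
  split_ifs
  · exact abs_nonneg _
  · exact edgeIndicator_nonneg _

theorem abs_centredBlock_le (p : unitInterval) (C : Fin n → Fin K) (R : Fin n → SyncGroup d 𝒢)
    (a : NodePair n) (z : Bool × SyncGroup d 𝒢) (b c : Fin d) :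
    |centredBlock p C R a.1.1 a.1.2 z b c| ≤ blockBound p C a z := by
  unfold centredBlock blockBound
  split_ifs
  · rw [Matrix.smul_apply, smul_eq_mul, abs_mul]
    exact mul_le_of_le_one_right (abs_nonneg _) (SyncGroup.abs_mat_mul_transpose_le_one _ _ _ _)
  · rw [Matrix.smul_apply, smul_eq_mul, abs_mul, abs_of_nonneg (edgeIndicator_nonneg _)]
    exact mul_le_of_le_one_right (edgeIndicator_nonneg _) (SyncGroup.abs_mat_le_one _ _ _)

/-- Reduces entries below the diagonal to those above, so bounds and means need checking only for
ordered pairs. -/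
theorem exists_centredEntry_eq (p : unitInterval) (C : Fin n → Fin K) (R : Fin n → SyncGroup d 𝒢)
    (x y : Fin n × Fin d) (h : x.1 ≠ y.1) : ∃ b c, ∀ z, centredEntry p C R x y z =
      centredBlock p C R (nodePair x.1 y.1 h).1.1 (nodePair x.1 y.1 h).1.2 z b c := by
  by_cases hlt : x.1 < y.1
  · exact ⟨x.2, y.2, fun z => by simp [centredEntry, nodePair, hlt]⟩
  · exact ⟨y.2, x.2, fun z => by simp [centredEntry, nodePair, hlt]⟩

theorem integral_comp_fst_pairMeasure (p q : unitInterval) (C : Fin n → Fin K) (a : NodePair n)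
    (f : Bool → ℝ) : ∫ z, f z.1 ∂pairMeasure p q C d 𝒢 a =
      ∫ b, f b ∂(bernoulliMeasure true false (if C a.1.1 = C a.1.2 then p else q)) := by
  have := integral_prod_mul (μ := bernoulliMeasure true false (if C a.1.1 = C a.1.2 then p else q))
    (ν := unif d 𝒢) f fun _ => (1 : ℝ)
  simpa [pairMeasure] using this

theorem integral_blockBound_le (p q : unitInterval) (C : Fin n → Fin K) (a : NodePair n) :
    ∫ z, blockBound p C a z ∂pairMeasure p q C d 𝒢 a ≤ 2 * max (p : ℝ) q := by
  have hp0 := p.2.1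
  have hp1 := p.2.2
  have hq0 := q.2.1
  have hm1 := le_max_left (p : ℝ) q
  have hm2 := le_max_right (p : ℝ) q
  unfold blockBound
  split_ifs with h
  · rw [integral_comp_fst_pairMeasure p q C a fun b => |edgeIndicator b - p|, if_pos h,
      integral_bernoulliMeasure]
    simp only [edgeIndicator, if_true, Bool.false_eq_true, if_false, smul_eq_mul, zero_sub, abs_neg]
    rw [abs_of_nonneg (by linarith), abs_of_nonneg hp0]
    -- Within a cluster the mean of `|w - p|` is `2p(1 - p)`; this is the source of the factor 2.
    nlinarith
  · rw [integral_comp_fst_pairMeasure p q C a edgeIndicator, if_neg h, integral_bernoulliMeasure]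
    simp only [edgeIndicator, if_true, Bool.false_eq_true, if_false, smul_eq_mul]
    linarith

theorem integrable_blockBound (p q : unitInterval) (C : Fin n → Fin K) (a : NodePair n) :
    Integrable (blockBound p C a) (pairMeasure p q C d 𝒢 a) := by
  refine Integrable.of_bound (C := 1) ?_ (ae_of_all _ fun z => ?_)
  · refine Measurable.aestronglyMeasurable ?_
    unfold blockBound
    split_ifs
    · exact measurable_comp_fst fun b => |edgeIndicator b - p|
    · exact measurable_comp_fst edgeIndicator
  · rw [Real.norm_eq_abs, abs_of_nonneg (blockBound_nonneg _ _ _ _)]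
    exact blockBound_le_one _ _ _ _

theorem integral_centredBlock (h𝒢 : 𝒢 = GroupKind.special → 2 ≤ d) (p q : unitInterval)
    (C : Fin n → Fin K) (R : Fin n → SyncGroup d 𝒢) (a : NodePair n) (b c : Fin d) :
    ∫ z, centredBlock p C R a.1.1 a.1.2 z b c ∂pairMeasure p q C d 𝒢 a = 0 := by
  unfold centredBlock
  split_ifs with h
  · simp only [Matrix.smul_apply, smul_eq_mul]
    rw [integral_mul_const, integral_comp_fst_pairMeasure p q C a fun b => edgeIndicator b - p,
      if_pos h, integral_bernoulliMeasure]
    simp only [edgeIndicator, if_true, Bool.false_eq_true, if_false, smul_eq_mul]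
    ring
  · simp only [Matrix.smul_apply, smul_eq_mul]
    rw [pairMeasure, integral_prod_mul (f := edgeIndicator)
      (g := fun Q : SyncGroup d 𝒢 => Q.mat b c), integral_mat_unif h𝒢, mul_zero]

theorem transpose_edgeMatrix_centredEntry (p : unitInterval) (C : Fin n → Fin K)
    (R : Fin n → SyncGroup d 𝒢) (ω : SGBMOutcome n d 𝒢) :
    (edgeMatrix (centredEntry p C R) ω).transpose = edgeMatrix (centredEntry p C R) ω := by
  ext x y
  simp only [edgeMatrix, Matrix.transpose_apply, Matrix.of_apply]
  by_cases h : x.1 = y.1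
  · simp [h]
  · rw [dif_neg h, dif_neg (Ne.symm h), nodePair_comm x.1 y.1 h]
    unfold centredEntry
    rcases lt_or_gt_of_ne h with h | h <;> simp [h, h.asymm]

theorem groundTruth_mul_transpose_apply (C : Fin n → Fin K) (R : Fin n → SyncGroup d 𝒢)
    (x y : Fin n × Fin d) : (groundTruth C R * (groundTruth C R).transpose) x y =
      if C x.1 = C y.1 then ((R x.1).mat * (R y.1).mat.transpose) x.2 y.2 else 0 := by
  simp only [Matrix.mul_apply, Matrix.transpose_apply, groundTruth, Matrix.of_apply,
    clusteringMatrix, Fintype.sum_prod_type]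
  split_ifs with h
  · rw [Finset.sum_eq_single (C x.1)]
    · simp [h]
    · intro k _ hk
      simp [hk.symm]
    · simp
  · refine Finset.sum_eq_zero fun k _ => Finset.sum_eq_zero fun c _ => ?_
    by_cases hx : C x.1 = k
    · have hy : C y.1 ≠ k := fun hy => h (hx.trans hy.symm)
      simp [hy]
    · simp [hx]

theorem upperBlock_sub (p : unitInterval) (C : Fin n → Fin K) (R : Fin n → SyncGroup d 𝒢)
    (ω : SGBMOutcome n d 𝒢) (e : NodePair n) (a b : Fin d) :
    upperBlock C R ω e a b - p * (if C e.1.1 = C e.1.2 then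
      ((R e.1.1).mat * (R e.1.2).mat.transpose) a b else 0) =
      centredBlock p C R e.1.1 e.1.2 (ω e) a b := by
  unfold upperBlock centredBlock edgeIndicator
  split_ifs <;> simp; ring

/-- On the diagonal the observation is the identity while the signal is `p` times the identity, so
`(1 - p) • 1` remains; it costs at most one in norm. -/
theorem observation_sub_eq (p : unitInterval) (C : Fin n → Fin K) (R : Fin n → SyncGroup d 𝒢)
    (ω : SGBMOutcome n d 𝒢) :
    observation C R ω - (p : ℝ) • (groundTruth C R * (groundTruth C R).transpose) =
      edgeMatrix (centredEntry p C R) ω + (1 - p : ℝ) • 1 := by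
  ext x y
  rw [Matrix.sub_apply, Matrix.smul_apply, Matrix.add_apply, Matrix.smul_apply,
    groundTruth_mul_transpose_apply, smul_eq_mul, smul_eq_mul]
  simp only [observation, observationBlock, edgeMatrix, Matrix.of_apply]
  rcases lt_trichotomy x.1 y.1 with h | h | h
  · have hne : x ≠ y := fun hxy => h.ne (congrArg Prod.fst hxy)
    rw [dif_pos h, dif_neg h.ne, Matrix.one_apply_ne hne, mul_zero, add_zero]
    have := upperBlock_sub p C R ω ⟨(x.1, y.1), h⟩ x.2 y.2
    simpa [centredEntry, h, nodePair] using this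
  · obtain ⟨i, a⟩ := x
    obtain ⟨j, b⟩ := y
    obtain rfl : i = j := h
    simp only [lt_irrefl, dif_neg, not_false_eq_true, if_true, dif_pos, zero_add,
      SyncGroup.mat_mul_transpose, Matrix.one_apply, Prod.mk.injEq, true_and]
    ring
  · have hne : x ≠ y := fun hxy => h.ne' (congrArg Prod.fst hxy)
    rw [dif_neg h.asymm, dif_pos h, dif_neg h.ne', Matrix.one_apply_ne hne, mul_zero, add_zero]
    have := upperBlock_sub p C R ω ⟨(y.1, x.1), h⟩ y.2 x.2
    have hT : ((R x.1).mat * (R y.1).mat.transpose) x.2 y.2 =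
        ((R y.1).mat * (R x.1).mat.transpose) y.2 x.2 := by
      rw [← Matrix.transpose_apply ((R x.1).mat * (R y.1).mat.transpose), Matrix.transpose_mul,
        Matrix.transpose_transpose]
    rw [hT]
    simpa [centredEntry, h.asymm, nodePair, eq_comm (a := C x.1)] using this

theorem IsBalanced.card_eq {m : ℕ} {C : Fin n → Fin K} (hC : IsBalanced m C) : n = K * m := by
  have := Finset.card_eq_sum_card_fiberwise (f := C) (s := Finset.univ) (t := Finset.univ)
    (fun _ _ => by simp)
  simpa [hC _] using this

end Model

/-! ### Choice of parameters and conclusion -/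

theorem Real.sqrt_add_le_sqrt_add_sqrt {a b : ℝ} (ha : 0 ≤ a) (hb : 0 ≤ b) :
    √(a + b) ≤ √a + √b := by
  refine Real.sqrt_le_iff.mpr ⟨by positivity, ?_⟩
  nlinarith [Real.sq_sqrt ha, Real.sq_sqrt hb, mul_nonneg (Real.sqrt_nonneg a) (Real.sqrt_nonneg b)]

theorem mainTheorem5 (K d : ℕ) (hK : 0 < K) (hd : 0 < d) (𝒢 : GroupKind)
    (h𝒢 : 𝒢 = GroupKind.special → 2 ≤ d) :
    ∃ c₁ c₂ c₃ γ : ℝ, 0 < c₁ ∧ 0 < c₂ ∧ 0 < c₃ ∧ 0 < γ ∧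
      ∀ (n m : ℕ) (_ : 0 < m) (p q : unitInterval) (C : Fin n → Fin K) (_ : IsBalanced m C)
        (R : Fin n → SyncGroup d 𝒢),
        1 - (n : ℝ) ^ (-γ) ≤
          (sgbm p q C d 𝒢).real {ω |
            opNorm (observation C R ω - (p : ℝ) • (groundTruth C R * (groundTruth C R).transpose))
              ≤ c₁ * √((q : ℝ) * m) + c₂ * √((p : ℝ) * m) + c₃ * √(Real.log n)} := by
  have hd0 : (0 : ℝ) < d := by exact_mod_cast hd
  have hK0 : (0 : ℝ) < K := by exact_mod_cast hK
  set B : ℝ := d ^ 3 * 10 ^ 9 * Real.exp 2 with hB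
  have hB0 : 0 < B := by positivity
  -- The factor `2 * K` comes from `nρ ≤ 2 K m (p + q)`. In the third constant, one `√B` belongs to
  -- `log n`; the rounding of `k` adds `√B` and the diagonal adds 1, both absorbed by `1 ≤ 2√(log
  -- n)`.
  refine ⟨√(B * (2 * K)), √(B * (2 * K)), 3 * √B + 2, 1, by positivity, by positivity,
    by positivity, one_pos, fun n m hm p q C hC R => ?_⟩
  have hn : n = K * m := hC.card_eq
  have hnpos : 0 < n := hn ▸ Nat.mul_pos hK hm
  rw [Real.rpow_neg_one]
  rcases Nat.lt_or_ge 1 n with hn2 | hn1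
  swap
  -- For a single node the claimed probability is zero.
  · obtain rfl : n = 1 := by omega
    simp
  have hp0 := p.2.1
  have hp1 := p.2.2
  have hq0 := q.2.1
  have hq1 := q.2.2
  have hlog2 : (1 / 4 : ℝ) ≤ Real.log n := by
    have : Real.log 2 ≤ Real.log n := Real.log_le_log (by norm_num) (by exact_mod_cast hn2)
    linarith [Real.log_two_gt_d9]
  -- The truncation at one is needed because the trace estimate assumes `ρ ≤ 1`.
  set ρ : ℝ := min 1 (2 * max (p : ℝ) q) with hρ
  have hρ0 : 0 ≤ ρ := le_min zero_le_one (by positivity)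
  -- The exponent must dominate `nρ` for the walk comparison and `log n` for the probability.
  set k : ℕ := ⌈n * ρ + Real.log n⌉₊ with hk
  have hk_ge : n * ρ + Real.log n ≤ k := Nat.le_ceil _
  have hnρ0 : 0 ≤ n * ρ := by positivity
  have hk_le : (k : ℝ) ≤ n * ρ + Real.log n + 1 := (Nat.ceil_lt_add_one (by linarith)).le
  have hkpos : 0 < k := Nat.ceil_pos.mpr (by linarith)
  have htail := measureReal_opNorm_edgeMatrix_le hd hnpos (pairMeasure p q C d 𝒢)
    (φ := centredEntry p C R) (g := blockBound p C) (measurable_centredEntry p C R)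
    (transpose_edgeMatrix_centredEntry p C R) (integrable_blockBound p q C) (blockBound_le_one p C)
    (fun x y h z => by
      obtain ⟨b, c, hbc⟩ := exists_centredEntry_eq p C R x y h
      rw [hbc]
      exact abs_centredBlock_le p C R _ z b c)
    (fun x y h => by
      obtain ⟨b, c, hbc⟩ := exists_centredEntry_eq p C R x y h
      simp only [hbc]
      exact integral_centredBlock h𝒢 p q C R _ b c)
    (ρ := ρ) hρ0 (min_le_left _ _)
    (fun a => le_min ((integral_mono (integrable_blockBound p q C a) (integrable_const 1)
      (blockBound_le_one p C a)).trans (by simp)) (integral_blockBound_le p q C a))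
    hkpos (by linarith) (by linarith)
  rw [← hB] at htail
  have hT : √(B * k) + 1 ≤ √(B * (2 * K)) * √((q : ℝ) * m) + √(B * (2 * K)) * √((p : ℝ) * m) +
      (3 * √B + 2) * √(Real.log n) := by
    have hone : 1 ≤ 2 * √(Real.log n) := by
      have : √(1 / 4 : ℝ) ≤ √(Real.log n) := Real.sqrt_le_sqrt hlog2
      have h2 : √(1 / 4 : ℝ) = 1 / 2 := by
        rw [show (1 / 4 : ℝ) = (1 / 2) ^ 2 by norm_num, Real.sqrt_sq (by norm_num)]
      linarith
    have hkb : B * k ≤ B * (2 * K) * (q * m) + B * (2 * K) * (p * m) + B * Real.log n + B := by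
      have h1 : ρ ≤ 2 * (q + p) := (min_le_right _ _).trans (by
        have : max (p : ℝ) q ≤ q + p := max_le (by linarith) (by linarith)
        linarith)
      have h2 : n * ρ ≤ K * m * (2 * (q + p)) := by
        have : (n : ℝ) = K * m := by exact_mod_cast hn
        rw [this]
        gcongr
      nlinarith
    have hsqrt : √(B * k) ≤ √(B * (2 * K)) * √((q : ℝ) * m) + √(B * (2 * K)) * √((p : ℝ) * m) +
        √B * √(Real.log n) + √B := by
      refine (Real.sqrt_le_sqrt hkb).trans ?_
      refine (Real.sqrt_add_le_sqrt_add_sqrt (by positivity) hB0.le).trans ?_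
      gcongr
      refine (Real.sqrt_add_le_sqrt_add_sqrt (by positivity) (by positivity)).trans ?_
      rw [← Real.sqrt_mul hB0.le, ← Real.sqrt_mul (by positivity), ← Real.sqrt_mul (by positivity)]
      gcongr
      exact Real.sqrt_add_le_sqrt_add_sqrt (by positivity) (by positivity)
    nlinarith [Real.sqrt_nonneg B]
  set G : Set (SGBMOutcome n d 𝒢) := {ω |
    opNorm (observation C R ω - (p : ℝ) • (groundTruth C R * (groundTruth C R).transpose))
      ≤ √(B * (2 * K)) * √((q : ℝ) * m) + √(B * (2 * K)) * √((p : ℝ) * m) +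
        (3 * √B + 2) * √(Real.log n)} with hG
  -- A covering with subadditivity, in place of complements, avoids any measurability of the two
  -- events.
  have hcover : Set.univ ⊆ G ∪ {ω | √(B * k) < opNorm (edgeMatrix (centredEntry p C R) ω)} := by
    intro ω _
    rcases lt_or_ge (√(B * k)) (opNorm (edgeMatrix (centredEntry p C R) ω)) with h | h
    · exact Or.inr h
    · left
      change opNorm _ ≤ _
      rw [observation_sub_eq]
      refine (opNorm_add_le _ _).trans (le_trans (add_le_add h ?_) hT)
      refine (opNorm_smul_one_le _).trans ?_
      rw [abs_of_nonneg (by linarith)]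
      linarith
  have hprob : (1 : ℝ) ≤ (sgbm p q C d 𝒢).real G +
      (sgbm p q C d 𝒢).real {ω | √(B * k) < opNorm (edgeMatrix (centredEntry p C R) ω)} := by
    calc (1 : ℝ) = (sgbm p q C d 𝒢).real Set.univ := by simp
      _ ≤ _ := measureReal_mono hcover
      _ ≤ _ := measureReal_union_le _ _
  have htail' : (sgbm p q C d 𝒢).real
      {ω | √(B * k) < opNorm (edgeMatrix (centredEntry p C R) ω)} ≤ (n : ℝ)⁻¹ := htail
  linarith
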